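/- Manifolds are smooth, paracompact, Hausdorff, connected, finite-dimensional and without boundary. Let $(\Sigma,\sigma)$ be a (smooth) Riemannian manifold with Riemannian distance $d_\sigma$ (the infimum of the $\sigma$-lengths of $C^1$ curves), and let $(\Sigma',\sigma')=(\mathbb{R}\times\Sigma,\,-dt^2\oplus\sigma)$ be the corresponding Lorentzian product, time oriented by $\partial_t$; write $t(p)=p_0$ for $p=(p_0,p_\Sigma)\in\Sigma'$. A tangent vector $v\neq 0$ of a spacetime $(M,g,X)$ (a Lorentzian manifold with a continuous timelike vector field $X$) is future directed causal if $g(v,v)\le 0$ and $g(v,X)<0$, and past directed causal if $-v$ is future directed causal. A future (past) directed causal curve is a locally Lipschitz curve on an interval $[a,b]$, $a<b$, whose velocity is future (past) directed causal almost everywhere. We write $p\le q$ if $p=q$ or there is a future directed causal curve from $p$ to $q$, and $J^+(p)=\{x: p\le x\}$, $J^-(q)=\{x: x\le q\}$. The spacetime is causal if it has no closed causal curve, stably causal if $M$ carries a causal spacetime structure $(g',X')$ for which every future directed $g$-causal vector is future directed $g'$-timelike, and globally hyperbolic if it is causal and all causal diamonds $J^+(p)\cap J^-(q)$ are compact. A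 time function is a continuous $\tau\colon M\to\mathbb{R}$ with $\tau(p)<\tau(q)$ whenever $p\le q$ and $p\ne q$. The null distance of $\tau$ is $$\hat d_\tau(p,q)=\inf\sum_{i=1}^k|\tau(\beta(a_i))-\tau(\beta(a_{i-1}))|,$$ the infimum being over all piecewise causal curves $\beta$ from $p$ to $q$, i.e. curves $\beta\colon[a_0,a_k]\to M$ with a partition $a_0<a_1<\dots<a_k$, $k\ge1$, such that each $\beta|_{[a_{i-1},a_i]}$ is a future or a past directed causal curve. Then $(\Sigma',\sigma')$ is a stably causal spacetime, $t$ is a time function on it, and the following hold. 1. $(\Sigma,d_\sigma)$ has the Heine–Borel property (every closed and bounded subset is compact) if and only if all causal diamonds of $(\Sigma',\sigma')$ are compact, and if and only if $(\Sigma',\sigma')$ is globally hyperbolic. 2. $(\Sigma,d_\sigma)$ is a complete metric space if and only if $(\Sigma',\hat d_t)$ is a complete metric space. Moreover, for all $p,q\in\Sigma'$, $$\hat d_t(p,q)=\max\{|t(q)-t(p)|,\ d_\sigma(p_\Sigma,q_\Sigma)\}.$$ -/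

import Mathlib

open scoped Manifold ContDiff ENNReal NNReal Topology
open Set Filter MeasureTheory Bundle

noncomputable section

namespace Spacetime

/-! ### Lorentzian metrics, time orientation, causal vectors -/

section General

variable {E : Type*} [NormedAddCommGroup E] [NormedSpace ℝ E]
  {H : Type*} [TopologicalSpace H] (I : ModelWithCorners ℝ E H)
  {M : Type*} [TopologicalSpace M] [ChartedSpace H M]

/-- `(M, g, X)` is a spacetime: `M` is Hausdorff, paracompact and connected, `g` is a smooth
symmetric nondegenerate covariant 2-tensor field whose index (the largest dimension of a subspace
of the tangent space on which `g` is negative definite) is `1` at every point, and `X` is a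
continuous timelike vector field, which provides the time orientation. -/
structure IsSpacetime [IsManifold I 1 M]
    (g : ∀ x : M, TangentSpace I x →L[ℝ] TangentSpace I x →L[ℝ] ℝ)
    (X : ∀ x : M, TangentSpace I x) : Prop where
  hausdorff : T2Space M
  paracompact : ParacompactSpace M
  connected : ConnectedSpace M
  smooth : ContMDiff I (I.prod 𝓘(ℝ, E →L[ℝ] E →L[ℝ] ℝ)) ∞
    (fun x : M ↦ TotalSpace.mk' (E →L[ℝ] E →L[ℝ] ℝ)
      (E := fun x : M ↦ TangentSpace I x →L[ℝ] TangentSpace I x →L[ℝ] ℝ) x (g x))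
  symm : ∀ (x : M) (v w : TangentSpace I x), g x v w = g x w v
  nondegenerate : ∀ (x : M) (v : TangentSpace I x), (∀ w, g x v w = 0) → v = 0
  index_one : ∀ x : M, IsGreatest
    {k : ℕ | ∃ W : Submodule ℝ (TangentSpace I x),
      Module.finrank ℝ W = k ∧ ∀ v ∈ W, v ≠ 0 → g x v v < 0} 1
  continuous_orientation :
    Continuous (fun x : M ↦ (TotalSpace.mk' E x (X x) : TangentBundle I M))
  timelike_orientation : ∀ x : M, g x (X x) (X x) < 0

variable (g : ∀ x : M, TangentSpace I x →L[ℝ] TangentSpace I x →L[ℝ] ℝ)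
  (X : ∀ x : M, TangentSpace I x)

/-- Future directed causal tangent vectors: nonzero, timelike or null, and `g(v, X) < 0`. -/
def IsFutureCausal {x : M} (v : TangentSpace I x) : Prop :=
  v ≠ 0 ∧ g x v v ≤ 0 ∧ g x v (X x) < 0

/-- Future directed timelike tangent vectors. -/
def IsFutureTimelike {x : M} (v : TangentSpace I x) : Prop :=
  g x v v < 0 ∧ g x v (X x) < 0

/-! ### Causal curves, the causal relation -/

/-- A curve `γ` is locally Lipschitz on `s`: it is continuous there, and near each of its points it
is Lipschitz when read in the preferred chart at that point. (Smooth charts are locally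
bi-Lipschitz for every background Riemannian metric, so this is the usual notion.) -/
def IsLocallyLipschitzCurve (γ : ℝ → M) (s : Set ℝ) : Prop :=
  ContinuousOn γ s ∧
    ∀ t ∈ s, ∃ K : ℝ≥0, ∃ u ∈ 𝓝[s] t, LipschitzOnWith K (fun r ↦ extChartAt I (γ t) (γ r)) u

/-- `γ` restricted to `[a, b]`, `a < b`, is a future directed causal curve: locally Lipschitz, with
future directed causal velocity at almost every parameter. (Where `γ` is not differentiable
`mfderiv` is `0`, which is not causal; so differentiability almost everywhere is implied.) -/
structure IsFutureCausalCurve (γ : ℝ → M) (a b : ℝ) : Prop where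
  lt : a < b
  lipschitz : IsLocallyLipschitzCurve I γ (Icc a b)
  causal : ∀ᵐ s ∂(volume.restrict (Icc a b)),
    IsFutureCausal I g X (mfderiv 𝓘(ℝ, ℝ) I γ s (1 : ℝ))

/-- `γ` restricted to `[a, b]`, `a < b`, is a past directed causal curve. -/
structure IsPastCausalCurve (γ : ℝ → M) (a b : ℝ) : Prop where
  lt : a < b
  lipschitz : IsLocallyLipschitzCurve I γ (Icc a b)
  causal : ∀ᵐ s ∂(volume.restrict (Icc a b)),
    IsFutureCausal I g X (-(mfderiv 𝓘(ℝ, ℝ) I γ s (1 : ℝ)))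

/-- There is a (nontrivial) future directed causal curve from `p` to `q`. -/
def ExistsCausalCurve (p q : M) : Prop :=
  ∃ (γ : ℝ → M) (a b : ℝ), IsFutureCausalCurve I g X γ a b ∧ γ a = p ∧ γ b = q

/-- The causal relation `p ≤ q`. -/
def CausalLE (p q : M) : Prop :=
  ExistsCausalCurve I g X p q ∨ p = q

/-- The causal diamond `J⁺(p) ∩ J⁻(q)`. -/
def causalDiamond (p q : M) : Set M :=
  {x | CausalLE I g X p x} ∩ {x | CausalLE I g X x q}

/-- Causality: there is no closed causal curve. -/
def IsCausal : Prop :=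
  ∀ p : M, ¬ ExistsCausalCurve I g X p p

/-- Global hyperbolicity: causality, and compactness of all causal diamonds. -/
def IsGloballyHyperbolic : Prop :=
  IsCausal I g X ∧ ∀ p q : M, IsCompact (causalDiamond I g X p q)

/-- Stable causality: some spacetime structure on `M` with strictly wider future causal cones
is causal. -/
def IsStablyCausal [IsManifold I 1 M] : Prop :=
  ∃ (g' : ∀ x : M, TangentSpace I x →L[ℝ] TangentSpace I x →L[ℝ] ℝ)
    (X' : ∀ x : M, TangentSpace I x),
    IsSpacetime I g' X' ∧
    (∀ (x : M) (v : TangentSpace I x), IsFutureCausal I g X v → IsFutureTimelike I g' X' v) ∧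
    IsCausal I g' X'

/-- A time function: continuous and strictly increasing along the causal relation. -/
def IsTimeFunction (τ : M → ℝ) : Prop :=
  Continuous τ ∧ ∀ p q : M, CausalLE I g X p q → p ≠ q → τ p < τ q

/-! ### The null distance -/

/-- `γ` restricted to `[a 0, a k]` is piecewise causal with respect to the partition
`a 0 < a 1 < ⋯ < a k`, `k ≥ 1`: on each subinterval it is a future or a past directed causal curve.
(Such a curve is locally Lipschitz on all of `[a 0, a k]`.) -/
def IsPiecewiseCausal (γ : ℝ → M) (k : ℕ) (a : ℕ → ℝ) : Prop :=
  0 < k ∧ ∀ i < k,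
    IsFutureCausalCurve I g X γ (a i) (a (i + 1)) ∨ IsPastCausalCurve I g X γ (a i) (a (i + 1))

/-- The null length of a curve with respect to a partition. -/
def nullLength (τ : M → ℝ) (γ : ℝ → M) (k : ℕ) (a : ℕ → ℝ) : ℝ :=
  ∑ i ∈ Finset.range k, |τ (γ (a (i + 1))) - τ (γ (a i))|

/-- The null distance: the infimum of the null lengths of the piecewise causal curves from `p` to
`q` (with value `∞` if there were no such curve). -/
def nullEDist (τ : M → ℝ) (p q : M) : ℝ≥0∞ :=
  ⨅ (γ : ℝ → M) (k : ℕ) (a : ℕ → ℝ)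
    (_ : IsPiecewiseCausal I g X γ k a ∧ γ (a 0) = p ∧ γ (a k) = q),
    ENNReal.ofReal (nullLength τ γ k a)

end General

/-! ### Metric notions, for a distance function given as a plain function -/

/-- `(Y, d)` is a complete metric space: `d` is a finite distance satisfying the axioms of a metric,
and every Cauchy sequence converges. -/
structure IsCompleteMetric {Y : Type*} (d : Y → Y → ℝ≥0∞) : Prop where
  ne_top : ∀ x y, d x y ≠ ⊤
  eq_zero_iff : ∀ x y, d x y = 0 ↔ x = y
  symm : ∀ x y, d x y = d y x
  triangle : ∀ x y z, d x z ≤ d x y + d y z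
  complete : ∀ u : ℕ → Y,
    (∀ ε : ℝ≥0∞, 0 < ε → ∃ N, ∀ m ≥ N, ∀ n ≥ N, d (u m) (u n) < ε) →
    ∃ x, Tendsto (fun n ↦ d (u n) x) atTop (𝓝 0)

/-- The Heine–Borel property: closed `d`-bounded subsets are compact. -/
def HeineBorel {Y : Type*} [TopologicalSpace Y] (d : Y → Y → ℝ≥0∞) : Prop :=
  ∀ C : Set Y, IsClosed C → (∃ r : ℝ≥0, ∀ x ∈ C, ∀ y ∈ C, d x y ≤ r) → IsCompact C

/-! ### The Lorentzian product -/

section Product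

variable (E : Type*) [NormedAddCommGroup E] [NormedSpace ℝ E]
  {S : Type*} [TopologicalSpace S] [ChartedSpace E S]

/-- The differential of the projection `t : ℝ × S → ℝ`, a covector on `ℝ × S`. -/
def dt (p : ℝ × S) : TangentSpace (𝓘(ℝ, ℝ).prod 𝓘(ℝ, E)) p →L[ℝ] ℝ :=
  mfderiv (𝓘(ℝ, ℝ).prod 𝓘(ℝ, E)) 𝓘(ℝ, ℝ) (Prod.fst : ℝ × S → ℝ) p

/-- The differential of the projection `ℝ × S → S`. -/
def dproj (p : ℝ × S) :
    TangentSpace (𝓘(ℝ, ℝ).prod 𝓘(ℝ, E)) p →L[ℝ] TangentSpace 𝓘(ℝ, E) p.2 :=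
  mfderiv (𝓘(ℝ, ℝ).prod 𝓘(ℝ, E)) 𝓘(ℝ, E) (Prod.snd : ℝ × S → S) p

/-- The coordinate vector field `∂ₜ`: the velocity of `s ↦ (s, x)`. -/
def timeField (p : ℝ × S) : TangentSpace (𝓘(ℝ, ℝ).prod 𝓘(ℝ, E)) p :=
  mfderiv 𝓘(ℝ, ℝ) (𝓘(ℝ, ℝ).prod 𝓘(ℝ, E)) (fun s : ℝ ↦ (s, p.2)) p.1 (1 : ℝ)

variable [RiemannianBundle (fun x : S ↦ TangentSpace 𝓘(ℝ, E) x)]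

/-- The Riemannian metric of `S`, as a bilinear form on each tangent space. -/
def riemMetric (x : S) : TangentSpace 𝓘(ℝ, E) x →L[ℝ] TangentSpace 𝓘(ℝ, E) x →L[ℝ] ℝ :=
  innerSL ℝ

/-- The product metric `-dt² ⊕ σ` on `ℝ × S`, where `σ` is the Riemannian metric of `S`. -/
def productMetric (p : ℝ × S) :
    TangentSpace (𝓘(ℝ, ℝ).prod 𝓘(ℝ, E)) p →L[ℝ]
      TangentSpace (𝓘(ℝ, ℝ).prod 𝓘(ℝ, E)) p →L[ℝ] ℝ :=
  -((dt E p).smulRight (dt E p)) +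
    (ContinuousLinearMap.precomp ℝ (dproj E p)).comp
      ((riemMetric E p.2).comp (dproj E p))

theorem productMetric_apply (p : ℝ × S) (v w : TangentSpace (𝓘(ℝ, ℝ).prod 𝓘(ℝ, E)) p) :
    productMetric E p v w = -(dt E p v * dt E p w) + inner ℝ (dproj E p v) (dproj E p w) := rfl

end Product

end Spacetime

end

/-!
Write `d` for the Riemannian distance of `S`. Everything rests on one comparison: a future causal
curve `(τ, c)` of `-dt² ⊕ σ` is a locally Lipschitz curve with `‖c'‖ ≤ τ'` almost everywhere, and this
forces `d(c a, c b) ≤ τ b - τ a` (`riemannianDist_le_of_ae_norm_mfderiv_le`). The Riemannian distance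
is defined by `C^1` curves, so this takes an argument: `s ↦ d(c a, c s)` is Lipschitz, its derivative
is at most `‖c'‖` wherever both exist (`eventually_riemannianEDist_le_of_mdifferentiableAt`), and
Lipschitz functions are integrals of their derivatives. The same principle shows that `t` is strictly
increasing along causal curves, even for the metric `-4 dt² ⊕ σ` with strictly wider cones; hence
causality, stable causality and the time function.

Conversely, a `C^1` curve `c` of length less than `L` lifts to the causal curve `(t, c)` as soon as
`t'` or `-t'` is at least `‖c'‖`. Letting `t` increase throughout gives `p ≤ q` whenever
`d(p.2, q.2) < q.1 - p.1` (`existsCausalCurve_of_riemannianDist_lt`); letting it increase and then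
decrease gives the upper bound for the null distance (`nullEDist_le_of_lt`). With the comparison on
each causal piece this proves the formula for the null distance (`nullEDist_fst_eq`), and the
equivalence of the two completeness properties is then a statement about the maximum metric on
`ℝ × S`.

If `S` has the Heine-Borel property, the causal relation is exactly `d(p.2, q.2) ≤ q.1 - p.1`
(`causalLE_of_riemannianDist_le`). For the boundary case one needs a `1`-Lipschitz curve realizing the
distance, obtained as an ultrafilter limit of almost shortest curves parametrized by arc length
(`exists_lipschitz_of_isCompact`). Such a curve is differentiable almost everywhere by Rademacher's
theorem, with velocity of norm at most `1` (`norm_mfderiv_le_one_of_riemannianEDist_le`), so its lift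
is causal. Causal diamonds are then closed and bounded, hence compact. Conversely each closed
bounded subset of `S` embeds in a slice of a causal diamond.
-/

noncomputable section

namespace Spacetime
open Manifold

/-! ### Maps into and out of a Riemannian manifold with bounded differential -/

section Riemannian

variable {E : Type*} [NormedAddCommGroup E] [NormedSpace ℝ E]
  {S : Type*} [TopologicalSpace S] [ChartedSpace E S]
  [RiemannianBundle (fun x : S ↦ TangentSpace 𝓘(ℝ, E) x)]
  {F : Type*} [NormedAddCommGroup F] [NormedSpace ℝ F]

/-- A map whose differential has norm at most `K` near `x` is `K`-Lipschitz for the Riemannian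
distance near `x`: an almost shortest path between two points close to `x` does not leave the
neighbourhood on which the bound holds. -/
theorem eventually_enorm_sub_le_riemannianEDist [IsManifold 𝓘(ℝ, E) 1 S]
    [IsContinuousRiemannianBundle E (fun x : S ↦ TangentSpace 𝓘(ℝ, E) x)] [RegularSpace S]
    {u : S → F} {x : S} {K : ℝ≥0}
    (hu : ∀ᶠ y in 𝓝 x, ContMDiffAt 𝓘(ℝ, E) 𝓘(ℝ, F) 1 u y)
    (hK : ∀ᶠ y in 𝓝 x, ∃ L : TangentSpace 𝓘(ℝ, E) y →L[ℝ] F,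
      HasMFDerivAt 𝓘(ℝ, E) 𝓘(ℝ, F) u y L ∧ ∀ w, ‖L w‖ₑ ≤ K * ‖w‖ₑ) :
    ∀ᶠ p in 𝓝 x ×ˢ 𝓝 x, ‖u p.2 - u p.1‖ₑ ≤ K * riemannianEDist 𝓘(ℝ, E) p.1 p.2 := by
  obtain ⟨c, c_pos, hc⟩ := setOfPred_riemannianEDist_lt_subset_nhds' 𝓘(ℝ, E)
    (Filter.inter_mem hu hK)
  -- both points are taken at distance less than `c / 4` of `x`, so that paths between them of
  -- length less than `c / 2` stay in the ball of radius `c`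
  have c4 : 0 < c / 4 := ENNReal.div_pos c_pos.ne' (by simp)
  have hx := eventually_riemannianEDist_lt 𝓘(ℝ, E) x c4
  filter_upwards [hx.prod_mk hx] with p hp
  set d := riemannianEDist 𝓘(ℝ, E) p.1 p.2
  have hd : d < c / 2 := by
    calc d ≤ riemannianEDist 𝓘(ℝ, E) p.1 x + riemannianEDist 𝓘(ℝ, E) x p.2 :=
          riemannianEDist_triangle
      _ < c / 4 + c / 4 := by
          rw [riemannianEDist_comm]
          exact ENNReal.add_lt_add hp.1 hp.2
      _ = c / 2 := by
          rw [← two_mul, ← mul_div_assoc, show (4 : ℝ≥0∞) = 2 * 2 by norm_num,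
            ENNReal.mul_div_mul_left _ _ (by simp) (by simp)]
  have key : ∀ r ∈ Ioo d (c / 2), ‖u p.2 - u p.1‖ₑ ≤ K * r := by
    rintro r ⟨hdr, hrc⟩
    obtain ⟨γ, γ0, γ1, γs, γl, -, -⟩ := exists_lt_locally_constant_of_riemannianEDist_lt hdr
      (zero_lt_one (α := ℝ))
    -- the path stays in the region where the differential is controlled
    have mem : ∀ t ∈ Icc (0 : ℝ) 1, riemannianEDist 𝓘(ℝ, E) x (γ t) < c := fun t ht ↦ by
      calc riemannianEDist 𝓘(ℝ, E) x (γ t)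
          ≤ riemannianEDist 𝓘(ℝ, E) x p.1 + riemannianEDist 𝓘(ℝ, E) p.1 (γ t) :=
            riemannianEDist_triangle
        _ < c / 2 + c / 2 := by
          apply ENNReal.add_lt_add (hp.1.trans_le _)
          · refine lt_of_le_of_lt ?_ hrc
            refine (riemannianEDist_le_pathELength γs.contMDiffOn γ0 rfl ht.1).trans ?_
            exact (pathELength_mono le_rfl ht.2).trans γl.le
          · exact ENNReal.div_le_div_left (by norm_num) _
        _ = c := ENNReal.add_halves c
    have hder : ∀ t ∈ Icc (0 : ℝ) 1, ∃ v : F, HasDerivAt (u ∘ γ) v t ∧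
        ‖v‖ₑ ≤ K * ‖mfderiv 𝓘(ℝ, ℝ) 𝓘(ℝ, E) γ t 1‖ₑ := fun t ht ↦ by
      obtain ⟨L, hL, hLK⟩ := (hc (mem t ht)).2
      refine ⟨L (mfderiv 𝓘(ℝ, ℝ) 𝓘(ℝ, E) γ t 1), ?_, hLK _⟩
      have h1 := (γs t).mdifferentiableAt one_ne_zero |>.hasMFDerivAt
      have h2 : HasFDerivAt (E := ℝ) (F := F) (u ∘ γ)
          (L.comp (mfderiv 𝓘(ℝ, ℝ) 𝓘(ℝ, E) γ t)) t := (hL.comp t h1).hasFDerivAt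
      exact h2.hasDerivAt
    have hC : ContDiffOn ℝ 1 (u ∘ γ) (Icc 0 1) := by
      rw [← contMDiffOn_iff_contDiffOn]
      intro t ht
      exact ((hc (mem t ht)).1.comp t (γs t)).contMDiffWithinAt
    calc ‖u p.2 - u p.1‖ₑ = ‖(u ∘ γ) 1 - (u ∘ γ) 0‖ₑ := by simp [γ0, γ1]
      _ ≤ ∫⁻ t in Icc (0 : ℝ) 1, ‖derivWithin (u ∘ γ) (Icc 0 1) t‖ₑ :=
          enorm_sub_le_lintegral_derivWithin_Icc_of_contDiffOn_Icc hC zero_le_one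
      _ ≤ ∫⁻ t in Icc (0 : ℝ) 1, K * ‖mfderiv 𝓘(ℝ, ℝ) 𝓘(ℝ, E) γ t 1‖ₑ := by
          apply setLIntegral_mono' measurableSet_Icc (fun t ht ↦ ?_)
          obtain ⟨v, hv, hvK⟩ := hder t ht
          rwa [hv.hasDerivWithinAt.derivWithin (uniqueDiffOn_Icc zero_lt_one t ht)]
      _ = K * pathELength 𝓘(ℝ, E) γ 0 1 := by
          rw [lintegral_const_mul' _ _ ENNReal.coe_ne_top, pathELength_eq_lintegral_mfderiv_Icc]
      _ ≤ K * r := by gcongr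
  have : (𝓝[>] d).NeBot := nhdsGT_neBot_of_exists_gt ⟨_, hd⟩
  refine ge_of_tendsto (x := 𝓝[>] d) (f := fun r : ℝ≥0∞ ↦ (K : ℝ≥0∞) * r) ?_ ?_
  · exact ((ENNReal.continuous_const_mul ENNReal.coe_ne_top).tendsto d).mono_left
      nhdsWithin_le_nhds
  · filter_upwards [Ioo_mem_nhdsGT hd] with r hr using key r hr

/-- A map from a normed space whose differential has norm at most `K` near `a` is `K`-Lipschitz into
the Riemannian distance near `a`: compare with the images of segments. -/
theorem eventually_riemannianEDist_le_enorm_sub {ψ : F → S} {a : F} {K : ℝ≥0}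
    (hψ : ∀ᶠ z in 𝓝 a, ContMDiffAt 𝓘(ℝ, F) 𝓘(ℝ, E) 1 ψ z)
    (hK : ∀ᶠ z in 𝓝 a, ∀ w : F, ‖mfderiv 𝓘(ℝ, F) 𝓘(ℝ, E) ψ z w‖ₑ ≤ K * ‖w‖ₑ) :
    ∀ᶠ p in 𝓝 a ×ˢ 𝓝 a,
      riemannianEDist 𝓘(ℝ, E) (ψ p.1) (ψ p.2) ≤ K * ‖p.2 - p.1‖ₑ := by
  obtain ⟨r, r_pos, hr⟩ := Metric.mem_nhds_iff.1 (Filter.inter_mem hψ hK)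
  have hb : ∀ᶠ z in 𝓝 a, z ∈ Metric.ball a r := Metric.ball_mem_nhds a r_pos
  filter_upwards [hb.prod_mk hb] with p hp
  let η : ℝ → F := fun t ↦ p.1 + t • (p.2 - p.1)
  have hη : ∀ t ∈ Icc (0 : ℝ) 1, η t ∈ Metric.ball a r := fun t ht ↦
    (convex_ball a r).add_smul_sub_mem hp.1 hp.2 ht
  have hηd : ∀ t, HasDerivAt η (p.2 - p.1) t := fun t ↦ by
    simpa [η] using ((hasDerivAt_id t).smul_const (p.2 - p.1)).const_add p.1
  have hηs : ContMDiff 𝓘(ℝ, ℝ) 𝓘(ℝ, F) 1 η := by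
    rw [contMDiff_iff_contDiff]; fun_prop
  have h1 : riemannianEDist 𝓘(ℝ, E) (ψ p.1) (ψ p.2) ≤ pathELength 𝓘(ℝ, E) (ψ ∘ η) 0 1 := by
    apply riemannianEDist_le_pathELength _ (by simp [η]) (by simp [η]) zero_le_one
    intro t ht
    exact ((hr (hη t ht)).1.comp t (hηs t)).contMDiffWithinAt
  refine h1.trans ?_
  rw [pathELength_eq_lintegral_mfderiv_Icc]
  calc ∫⁻ t in Icc (0 : ℝ) 1, ‖mfderiv 𝓘(ℝ, ℝ) 𝓘(ℝ, E) (ψ ∘ η) t 1‖ₑ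
      ≤ ∫⁻ t in Icc (0 : ℝ) 1, K * ‖p.2 - p.1‖ₑ := by
        apply setLIntegral_mono' measurableSet_Icc (fun t ht ↦ ?_)
        have h2 : HasMFDerivAt 𝓘(ℝ, F) 𝓘(ℝ, E) ψ (η t) (mfderiv 𝓘(ℝ, F) 𝓘(ℝ, E) ψ (η t)) :=
          ((hr (hη t ht)).1.mdifferentiableAt one_ne_zero).hasMFDerivAt
        have h3 := h2.comp t (hηd t).hasFDerivAt.hasMFDerivAt
        calc ‖mfderiv 𝓘(ℝ, ℝ) 𝓘(ℝ, E) (ψ ∘ η) t 1‖ₑ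
            = ‖mfderiv 𝓘(ℝ, F) 𝓘(ℝ, E) ψ (η t) ((1 : ℝ) • (p.2 - p.1))‖ₑ := by
              rw [h3.mfderiv]; rfl
          _ ≤ K * ‖p.2 - p.1‖ₑ := by rw [one_smul]; exact (hr (hη t ht)).2 _
    _ = K * ‖p.2 - p.1‖ₑ := by simp

end Riemannian

/-! ### Charts and velocities on a Riemannian manifold -/

section Riemannian

variable {E : Type*} [NormedAddCommGroup E] [NormedSpace ℝ E]
  {S : Type*} [TopologicalSpace S] [ChartedSpace E S] [IsManifold 𝓘(ℝ, E) 1 S]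
  [RiemannianBundle (fun x : S ↦ TangentSpace 𝓘(ℝ, E) x)]
  [IsContinuousRiemannianBundle E (fun x : S ↦ TangentSpace 𝓘(ℝ, E) x)]

/-- Charts are locally Lipschitz for the Riemannian distance; unlike in
`setOfPred_riemannianEDist_lt_subset_nhds`, both points vary. -/
theorem eventually_enorm_extChartAt_sub_le [RegularSpace S] (x : S) :
    ∃ K : ℝ≥0, ∀ᶠ p in 𝓝 x ×ˢ 𝓝 x,
      ‖extChartAt 𝓘(ℝ, E) x p.2 - extChartAt 𝓘(ℝ, E) x p.1‖ₑ ≤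
        K * riemannianEDist 𝓘(ℝ, E) p.1 p.2 := by
  obtain ⟨C, C_pos, hC⟩ := eventually_norm_trivializationAt_lt E
    (fun x : S ↦ TangentSpace 𝓘(ℝ, E) x) x
  lift C to ℝ≥0 using C_pos.le
  refine ⟨C, eventually_enorm_sub_le_riemannianEDist ?_ ?_⟩
  · filter_upwards [chart_source_mem_nhds E x] with y hy
    exact contMDiffAt_extChartAt' hy
  · filter_upwards [chart_source_mem_nhds E x, hC] with y hy hyC
    refine ⟨(trivializationAt E (TangentSpace 𝓘(ℝ, E)) x).continuousLinearMapAt ℝ y, ?_, ?_⟩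
    · rw [TangentBundle.continuousLinearMapAt_trivializationAt hy]
      exact (mdifferentiableAt_extChartAt hy).hasMFDerivAt
    · intro w
      refine (ContinuousLinearMap.le_opENorm _ _).trans ?_
      gcongr
      rw [← ofReal_norm]
      exact ENNReal.ofReal_le_of_le_toReal hyC.le

section
attribute [local instance] normedAddCommGroupTangentSpaceVectorSpace
  normedSpaceTangentSpaceVectorSpace

/-- Inverse charts are locally Lipschitz for the Riemannian distance; unlike in
`eventually_riemannianEDist_le_edist_extChartAt`, both points vary. -/
theorem eventually_riemannianEDist_le_enorm_extChartAt_sub (x : S) :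
    ∃ K : ℝ≥0, ∀ᶠ p in 𝓝 x ×ˢ 𝓝 x, riemannianEDist 𝓘(ℝ, E) p.1 p.2 ≤
      K * ‖extChartAt 𝓘(ℝ, E) x p.2 - extChartAt 𝓘(ℝ, E) x p.1‖ₑ := by
  obtain ⟨C, -, hC⟩ := eventually_enorm_mfderivWithin_symm_extChartAt_lt 𝓘(ℝ, E) x
  refine ⟨C, ?_⟩
  have h := eventually_riemannianEDist_le_enorm_sub (E := E) (S := S) (F := E) (K := C)
    (ψ := (extChartAt 𝓘(ℝ, E) x).symm) (a := extChartAt 𝓘(ℝ, E) x x) ?_ ?_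
  · have ht : Tendsto (extChartAt 𝓘(ℝ, E) x) (𝓝 x) (𝓝 (extChartAt 𝓘(ℝ, E) x x)) :=
      continuousAt_extChartAt x
    have hs : ∀ᶠ y in 𝓝 x, y ∈ (extChartAt 𝓘(ℝ, E) x).source := extChartAt_source_mem_nhds x
    filter_upwards [(ht.prodMap ht).eventually h, hs.prod_mk hs] with p hp hps
    simpa only [Prod.map_fst, Prod.map_snd, (extChartAt 𝓘(ℝ, E) x).left_inv hps.1,
      (extChartAt 𝓘(ℝ, E) x).left_inv hps.2] using hp
  · filter_upwards [extChartAt_target_mem_nhds x] with z hz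
    exact (contMDiffOn_extChartAt_symm x).contMDiffAt ((isOpen_extChartAt_target x).mem_nhds hz)
  · rw [ModelWithCorners.range_eq_univ, nhdsWithin_univ] at hC
    filter_upwards [hC] with z hz w
    rw [mfderivWithin_univ] at hz
    refine (ContinuousLinearMap.le_opENorm _ _).trans ?_
    gcongr
    · exact hz.le
    · exact le_rfl

end

theorem continuousAt_norm_mfderiv {γ : ℝ → S} {s : ℝ}
    (hγ : ContMDiffAt 𝓘(ℝ, ℝ) 𝓘(ℝ, E) 1 γ s) :
    ContinuousAt (fun t ↦ ‖mfderiv 𝓘(ℝ, ℝ) 𝓘(ℝ, E) γ t 1‖) s := by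
  have h1 : ContinuousAt (fun t ↦ (⟨γ t, mfderiv 𝓘(ℝ, ℝ) 𝓘(ℝ, E) γ t 1⟩ :
      TotalSpace E (TangentSpace 𝓘(ℝ, E) : S → Type _))) s := by
    obtain ⟨U, hU, hγU⟩ := (contMDiffAt_iff_contMDiffOn_nhds (by simp)).1 hγ
    obtain ⟨V, hVU, hV, hsV⟩ := mem_nhds_iff.1 hU
    have h2 := (hγU.mono hVU).continuousOn_tangentMapWithin le_rfl hV.uniqueMDiffOn
    have h3 : ContinuousOn (fun t : ℝ ↦ tangentMapWithin 𝓘(ℝ, ℝ) 𝓘(ℝ, E) γ V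
        (⟨t, (1 : ℝ)⟩ : TangentBundle 𝓘(ℝ, ℝ) ℝ)) V := by
      refine h2.comp ?_ (fun t ht ↦ ht)
      apply Continuous.continuousOn
      have := (tangentBundleModelSpaceHomeomorph (I := 𝓘(ℝ, ℝ))).symm.continuous.comp
        (continuous_id.prodMk (continuous_const (y := (1 : ℝ))))
      exact this
    refine (h3.continuousAt (hV.mem_nhds hsV)).congr ?_
    filter_upwards [hV.mem_nhds hsV] with t ht
    rw [tangentMapWithin, mfderivWithin_of_mem_nhds (hV.mem_nhds ht)]
    rfl
  have h4 := h1.inner_bundle h1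
  simp only [real_inner_self_eq_norm_sq] at h4
  simpa [Real.sqrt_sq] using h4.sqrt

theorem riemannianEDist_ne_top [PreconnectedSpace S] (x y : S) :
    riemannianEDist 𝓘(ℝ, E) x y ≠ ⊤ := by
  have ho : ∀ z : S, ∀ᶠ w in 𝓝 z, riemannianEDist 𝓘(ℝ, E) z w < ⊤ := fun z ↦
    eventually_riemannianEDist_lt 𝓘(ℝ, E) z (by simp)
  have hclopen : IsClopen {z : S | riemannianEDist 𝓘(ℝ, E) x z < ⊤} := by
    constructor
    · rw [← isOpen_compl_iff, isOpen_iff_mem_nhds]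
      intro z hz
      filter_upwards [ho z] with w hw hxw
      apply hz
      refine lt_of_le_of_lt (riemannianEDist_triangle (y := w)) ?_
      rw [riemannianEDist_comm (x := w)]
      exact ENNReal.add_lt_top.2 ⟨hxw, hw⟩
    · rw [isOpen_iff_mem_nhds]
      intro z hz
      filter_upwards [ho z] with w hw
      exact lt_of_le_of_lt riemannianEDist_triangle (ENNReal.add_lt_top.2 ⟨hz, hw⟩)
  have := hclopen.eq_univ ⟨x, by simp [riemannianEDist_self]⟩
  have hy : y ∈ {z : S | riemannianEDist 𝓘(ℝ, E) x z < ⊤} := by rw [this]; trivial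
  exact hy.ne

end Riemannian

section Riemannian

variable {E : Type*} [NormedAddCommGroup E] [NormedSpace ℝ E]
  {S : Type*} [TopologicalSpace S] [ChartedSpace E S] [IsManifold 𝓘(ℝ, E) 1 S]

omit [IsManifold 𝓘(ℝ, E) 1 S] in
/-- The norm of the velocity of `κ` at `s`, computed in the preferred chart at `x = κ s`. The
equality `κ s = x` need not be definitional, which is why this is a statement about norms rather
than about tangent vectors. -/
theorem norm_mfderiv_eq_of_hasDerivAt
    [RiemannianBundle (fun x : S ↦ TangentSpace 𝓘(ℝ, E) x)] {κ : ℝ → S} {s : ℝ} {x : S} (hx : κ s = x) {w : E}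
    (hκ : MDifferentiableAt 𝓘(ℝ, ℝ) 𝓘(ℝ, E) κ s)
    (hw : HasDerivAt (extChartAt 𝓘(ℝ, E) x ∘ κ) w s) :
    ‖mfderiv 𝓘(ℝ, ℝ) 𝓘(ℝ, E) κ s 1‖ = ‖(show TangentSpace 𝓘(ℝ, E) x from w)‖ := by
  subst hx
  have h : HasMFDerivAt 𝓘(ℝ, ℝ) 𝓘(ℝ, E) κ s (ContinuousLinearMap.toSpanSingleton ℝ w) := by
    refine ⟨hκ.continuousAt, ?_⟩
    have : writtenInExtChartAt 𝓘(ℝ, ℝ) 𝓘(ℝ, E) s κ = extChartAt 𝓘(ℝ, E) (κ s) ∘ κ := by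
      ext t; rfl
    rw [this]
    exact hw.hasFDerivAt.hasFDerivWithinAt
  have h2 : mfderiv 𝓘(ℝ, ℝ) 𝓘(ℝ, E) κ s 1 = w := by
    rw [h.mfderiv]
    exact one_smul ℝ w
  rw [h2]

theorem hasDerivAt_extChartAt_comp {κ : ℝ → S} {s : ℝ}
    (hκ : MDifferentiableAt 𝓘(ℝ, ℝ) 𝓘(ℝ, E) κ s) :
    ∃ w : E, HasDerivAt (extChartAt 𝓘(ℝ, E) (κ s) ∘ κ) w s := by
  have h1 : MDifferentiableAt 𝓘(ℝ, ℝ) 𝓘(ℝ, E) (extChartAt 𝓘(ℝ, E) (κ s) ∘ κ) s :=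
    (mdifferentiableAt_extChartAt (mem_chart_source E (κ s))).comp s hκ
  exact ⟨_, h1.differentiableAt.hasDerivAt⟩

variable [RiemannianBundle (fun x : S ↦ TangentSpace 𝓘(ℝ, E) x)]
  [IsContinuousRiemannianBundle E (fun x : S ↦ TangentSpace 𝓘(ℝ, E) x)]

/-- Metric speed is at most the norm of the velocity. The curve is compared with the straight line
in the chart that is tangent to it, whose speed is continuous. -/
theorem eventually_riemannianEDist_le_of_mdifferentiableAt {c : ℝ → S} {s : ℝ}
    (hc : MDifferentiableAt 𝓘(ℝ, ℝ) 𝓘(ℝ, E) c s) {K : ℝ≥0}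
    (hK : ‖mfderiv 𝓘(ℝ, ℝ) 𝓘(ℝ, E) c s 1‖ < K) :
    ∀ᶠ h in 𝓝 s, riemannianEDist 𝓘(ℝ, E) (c s) (c h) ≤ K * ‖h - s‖ₑ := by
  -- room for the error of the linear approximation, which costs at most `K - K'`
  obtain ⟨K', hK', hK'K⟩ := exists_between hK
  lift K' to ℝ≥0 using (norm_nonneg _).trans hK'.le
  rw [NNReal.coe_lt_coe] at hK'K
  obtain ⟨w, hw⟩ := hasDerivAt_extChartAt_comp hc
  rw [norm_mfderiv_eq_of_hasDerivAt rfl hc hw] at hK'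
  obtain ⟨C, hC⟩ := eventually_riemannianEDist_le_enorm_extChartAt_sub (E := E) (c s)
  set φ := extChartAt 𝓘(ℝ, E) (c s) with hφ
  -- `γ` is the straight line in the chart, tangent to `c` at `s`
  let η : ℝ → E := fun t ↦ φ (c s) + (t - s) • w
  have hη0 : η s = φ (c s) := by simp [η]
  have hηc : Continuous η := by fun_prop
  have hηt : ∀ᶠ t in 𝓝 s, η t ∈ φ.target :=
    hηc.continuousAt.eventually (by rw [hη0]; exact extChartAt_target_mem_nhds (c s))
  have hηd : HasDerivAt η w s := by
    simpa [η] using (((hasDerivAt_id s).sub_const s).smul_const w).const_add (φ (c s))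
  let γ : ℝ → S := fun t ↦ φ.symm (η t)
  have hγ0 : γ s = c s := by
    simp only [γ, hη0]; exact extChartAt_to_inv (I := 𝓘(ℝ, E)) (c s)
  have hγs : ∀ᶠ t in 𝓝 s, ContMDiffAt 𝓘(ℝ, ℝ) 𝓘(ℝ, E) 1 γ t := by
    filter_upwards [hηt] with t ht
    have h1 : ContMDiffAt 𝓘(ℝ, E) 𝓘(ℝ, E) 1 φ.symm (η t) :=
      (contMDiffOn_extChartAt_symm (c s)).contMDiffAt
        ((isOpen_extChartAt_target (c s)).mem_nhds ht)
    refine h1.comp t ?_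
    rw [contMDiffAt_iff_contDiffAt]
    fun_prop
  have hφγ : φ ∘ γ =ᶠ[𝓝 s] η := by
    filter_upwards [hηt] with t ht using φ.right_inv ht
  have hγK : ∀ᶠ t in 𝓝 s, ‖mfderiv 𝓘(ℝ, ℝ) 𝓘(ℝ, E) γ t 1‖ < K' := by
    refine (continuousAt_norm_mfderiv hγs.self_of_nhds).eventually_lt continuousAt_const ?_
    rwa [norm_mfderiv_eq_of_hasDerivAt hγ0 (hγs.self_of_nhds.mdifferentiableAt one_ne_zero)
      (hηd.congr_of_eventuallyEq hφγ)]
  have h1 := eventually_riemannianEDist_le_enorm_sub (E := E) (K := K') hγs (by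
    filter_upwards [hγK] with t ht w
    have : mfderiv 𝓘(ℝ, ℝ) 𝓘(ℝ, E) γ t w = w • mfderiv 𝓘(ℝ, ℝ) 𝓘(ℝ, E) γ t (1 : ℝ) := by
      calc mfderiv 𝓘(ℝ, ℝ) 𝓘(ℝ, E) γ t w = mfderiv 𝓘(ℝ, ℝ) 𝓘(ℝ, E) γ t (w • (1 : ℝ)) := by
            rw [smul_eq_mul, mul_one]
        _ = _ := (mfderiv 𝓘(ℝ, ℝ) 𝓘(ℝ, E) γ t).map_smul w _
    rw [this, enorm_smul, mul_comm]
    gcongr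
    rw [← ofReal_norm]
    exact ENNReal.ofReal_le_of_le_toReal ht.le)
  have ht1 : Tendsto (fun h ↦ (s, h)) (𝓝 s) (𝓝 s ×ˢ 𝓝 s) :=
    tendsto_const_nhds.prodMk tendsto_id
  have ht2 : Tendsto (fun h ↦ (γ h, c h)) (𝓝 s) (𝓝 (c s) ×ˢ 𝓝 (c s)) :=
    (by simpa only [hγ0] using hγs.self_of_nhds.continuousAt.tendsto : Tendsto γ _ _).prodMk
      hc.continuousAt
  -- chosen so that `K' + C * ε ≤ K`
  let ε : ℝ≥0 := (K - K') / (C + 1)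
  have hε : 0 < ε := by
    have : 0 < K - K' := tsub_pos_of_lt hK'K
    positivity
  have hlo : ∀ᶠ h in 𝓝 s, ‖φ (c h) - η h‖ ≤ ε * ‖h - s‖ := by
    have := (hw.hasFDerivAt.isLittleO.def (c := ε) (by exact_mod_cast hε))
    filter_upwards [this] with h hh
    have h1 : φ (c h) - η h = (φ ∘ c) h - (φ ∘ c) s -
        (ContinuousLinearMap.toSpanSingleton ℝ w) (h - s) := by
      simp [η]
      abel
    rw [h1]
    exact hh
  filter_upwards [ht1.eventually h1, ht2.eventually hC, hφγ, hlo] with h h1 h2 h3 h4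
  have h1 : riemannianEDist 𝓘(ℝ, E) (c s) (γ h) ≤ K' * ‖h - s‖ₑ := hγ0 ▸ h1
  have h3' : φ (γ h) = η h := h3
  simp only [h3'] at h2
  have h5 : ‖φ (c h) - η h‖ₑ ≤ ε * ‖h - s‖ₑ := by
    rw [← ofReal_norm, ← ofReal_norm, ← ENNReal.ofReal_coe_nnreal, ← ENNReal.ofReal_mul
      (by positivity)]
    exact ENNReal.ofReal_le_ofReal h4
  calc riemannianEDist 𝓘(ℝ, E) (c s) (c h)
      ≤ riemannianEDist 𝓘(ℝ, E) (c s) (γ h) + riemannianEDist 𝓘(ℝ, E) (γ h) (c h) :=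
        riemannianEDist_triangle
    _ ≤ K' * ‖h - s‖ₑ + C * (ε * ‖h - s‖ₑ) := by gcongr; exact h2.trans (by gcongr)
    _ = ((K' + C * ε : ℝ≥0) : ℝ≥0∞) * ‖h - s‖ₑ := by push_cast; ring
    _ ≤ K * ‖h - s‖ₑ := by
      gcongr
      have : (C : ℝ≥0) * ε ≤ K - K' := by
        simp only [ε]
        rw [mul_div_assoc', div_le_iff₀ (by positivity), mul_comm]
        gcongr
        exact le_self_add
      calc K' + C * ε ≤ K' + (K - K') := by gcongr
        _ = K := add_tsub_cancel_of_le hK'K.le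

/-- A curve which is `1`-Lipschitz for the Riemannian distance has velocity of norm at most `1` where
it is differentiable. Since the trivialization at `x` distorts norms by factors close to `1`, the
function `y ↦ ⟪V, φ y⟫`, with `φ` the chart at `x` and `V` the velocity, is `‖V‖ * r`-Lipschitz near
`x` for every `r > 1`, and its derivative along the curve is `‖V‖ ^ 2`. -/
theorem norm_mfderiv_le_one_of_riemannianEDist_le [RegularSpace S] {f : ℝ → S} {s : ℝ}
    (hf : MDifferentiableAt 𝓘(ℝ, ℝ) 𝓘(ℝ, E) f s)
    (hL : ∀ᶠ h in 𝓝 s, riemannianEDist 𝓘(ℝ, E) (f s) (f h) ≤ ‖h - s‖ₑ) :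
    ‖mfderiv 𝓘(ℝ, ℝ) 𝓘(ℝ, E) f s 1‖ ≤ 1 := by
  set x := f s with hx
  set V : TangentSpace 𝓘(ℝ, E) x := mfderiv 𝓘(ℝ, ℝ) 𝓘(ℝ, E) f s 1 with hV
  -- the bound is proved for every `r > 1` in place of `1`
  refine le_of_forall_gt_imp_ge_of_dense fun r hr ↦ ?_
  rcases eq_or_ne V 0 with h0 | h0
  · rw [h0, norm_zero]; linarith
  have hVpos : 0 < ‖V‖ := norm_pos_iff.2 h0
  let T := trivializationAt E (TangentSpace 𝓘(ℝ, E)) x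
  let l : E →L[ℝ] ℝ := (innerSL ℝ V).comp (T.symmL ℝ x)
  let u : S → ℝ := fun y ↦ l (extChartAt 𝓘(ℝ, E) x y)
  have hd : ∀ y ∈ (chartAt E x).source, HasMFDerivAt 𝓘(ℝ, E) 𝓘(ℝ, ℝ) u y
      (l.comp (T.continuousLinearMapAt ℝ y)) := fun y hy ↦ by
    have h1 : HasMFDerivAt 𝓘(ℝ, E) 𝓘(ℝ, E) (extChartAt 𝓘(ℝ, E) x) y
        (T.continuousLinearMapAt ℝ y) := by
      simp only [T]
      rw [TangentBundle.continuousLinearMapAt_trivializationAt hy]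
      exact (mdifferentiableAt_extChartAt hy).hasMFDerivAt
    exact l.hasMFDerivAt.comp y h1
  have hr0 : 0 ≤ ‖V‖ * r := by positivity
  have hlip := eventually_enorm_sub_le_riemannianEDist (E := E) (u := u) (x := x)
    (K := (‖V‖ * r).toNNReal)
    (by
      filter_upwards [chart_source_mem_nhds E x] with y hy
      exact l.contMDiff.contMDiffAt.comp y (contMDiffAt_extChartAt' hy))
    (by
      filter_upwards [chart_source_mem_nhds E x,
        eventually_norm_symmL_trivializationAt_self_comp_lt E
          (fun x : S ↦ TangentSpace 𝓘(ℝ, E) x) x hr] with y hy hyr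
      refine ⟨_, hd y hy, fun w ↦ ?_⟩
      have h1 : ‖l (T.continuousLinearMapAt ℝ y w)‖ ≤ ‖V‖ * r * ‖w‖ := by
        calc ‖l (T.continuousLinearMapAt ℝ y w)‖
            = ‖inner ℝ V (((T.symmL ℝ x) ∘L (T.continuousLinearMapAt ℝ y)) w)‖ := rfl
          _ ≤ ‖V‖ * ‖((T.symmL ℝ x) ∘L (T.continuousLinearMapAt ℝ y)) w‖ :=
              norm_inner_le_norm _ _
          _ ≤ ‖V‖ * (r * ‖w‖) := by
              gcongr
              exact ContinuousLinearMap.le_of_opNorm_le _ hyr.le w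
          _ = ‖V‖ * r * ‖w‖ := by ring
      have h2 := ENNReal.ofReal_le_ofReal h1
      rw [ENNReal.ofReal_mul hr0, ofReal_norm, ofReal_norm] at h2
      exact h2)
  have hxs : x ∈ (chartAt E x).source := mem_chart_source E x
  have hder : HasDerivAt (u ∘ f) (l (T.continuousLinearMapAt ℝ x V)) s := by
    have h1 : HasFDerivAt (E := ℝ) (F := ℝ) (u ∘ f)
        ((l.comp (T.continuousLinearMapAt ℝ x)).comp (mfderiv 𝓘(ℝ, ℝ) 𝓘(ℝ, E) f s)) s :=
      ((hd x hxs).comp s hf.hasMFDerivAt).hasFDerivAt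
    exact h1.hasDerivAt
  have hval : l (T.continuousLinearMapAt ℝ x V) = ‖V‖ * ‖V‖ := by
    have h1 : T.symmL ℝ x (T.continuousLinearMapAt ℝ x V) = V :=
      T.symmL_continuousLinearMapAt (FiberBundle.mem_baseSet_trivializationAt' x) V
    calc l (T.continuousLinearMapAt ℝ x V)
        = inner ℝ V (T.symmL ℝ x (T.continuousLinearMapAt ℝ x V)) := rfl
      _ = ‖V‖ * ‖V‖ := by rw [h1, real_inner_self_eq_norm_mul_norm]
  have ht : Tendsto (fun h ↦ (f s, f h)) (𝓝 s) (𝓝 x ×ˢ 𝓝 x) :=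
    tendsto_const_nhds.prodMk hf.continuousAt
  have hb : ‖l (T.continuousLinearMapAt ℝ x V)‖ ≤ ‖V‖ * r := by
    refine hder.le_of_lip' hr0 ?_
    filter_upwards [ht.eventually hlip, hL] with h h1 h2
    have h3 : ‖u (f h) - u (f s)‖ₑ ≤ ENNReal.ofReal (‖V‖ * r * ‖h - s‖) := by
      rw [ENNReal.ofReal_mul hr0, ofReal_norm]
      refine h1.trans ?_
      rw [ENNReal.ofReal]
      gcongr
    rw [← ofReal_norm] at h3
    exact (ENNReal.ofReal_le_ofReal_iff (by positivity)).1 h3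
  rw [hval, norm_mul, norm_norm] at hb
  exact le_of_mul_le_mul_left hb hVpos

end Riemannian

/-! ### Lipschitz functions with a signed derivative -/

section RealAnalysis

theorem apply_le_of_ae_hasDerivAt_nonneg {h : ℝ → ℝ} {a b : ℝ} {K : ℝ≥0} (hab : a ≤ b)
    (hh : LipschitzOnWith K h (Icc a b))
    (hd : ∀ᵐ s ∂(volume.restrict (Icc a b)), ∀ m, HasDerivAt h m s → 0 ≤ m) : h a ≤ h b := by
  rw [← uIcc_of_le hab] at hh
  have hac := hh.absolutelyContinuousOnInterval
  rw [← sub_nonneg, ← hac.integral_deriv_eq_sub]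
  apply intervalIntegral.integral_nonneg_of_ae_restrict hab
  have h1 := hac.ae_differentiableAt
  rw [uIcc_of_le hab, ← ae_restrict_iff' measurableSet_Icc] at h1
  filter_upwards [h1, hd] with s hs1 hs2 using hs2 _ hs1.hasDerivAt

theorem apply_lt_of_ae_hasDerivAt_pos {h : ℝ → ℝ} {a b : ℝ} {K : ℝ≥0} (hab : a < b)
    (hh : LipschitzOnWith K h (Icc a b))
    (hd : ∀ᵐ s ∂(volume.restrict (Icc a b)), ∀ m, HasDerivAt h m s → 0 < m) : h a < h b := by
  rw [← uIcc_of_le hab.le] at hh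
  have hac := hh.absolutelyContinuousOnInterval
  rw [← sub_pos, ← hac.integral_deriv_eq_sub]
  have h1 := hac.ae_differentiableAt
  rw [uIcc_of_le hab.le, ← ae_restrict_iff' measurableSet_Icc] at h1
  have h2 : ∀ᵐ s ∂(volume.restrict (Icc a b)), 0 < deriv h s := by
    filter_upwards [h1, hd] with s hs1 hs2 using hs2 _ hs1.hasDerivAt
  rw [← restrict_Ioc_eq_restrict_Icc] at h2
  rw [intervalIntegral.integral_pos_iff_support_of_nonneg_ae' (by
    rw [uIoc_of_le hab.le]
    filter_upwards [h2] with s hs using hs.le) hac.intervalIntegrable_deriv]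
  refine ⟨hab, ?_⟩
  have h3 : volume (Ioc a b) ≤ volume (Function.support (deriv h) ∩ Ioc a b) := by
    rw [← Measure.restrict_apply_self volume (Ioc a b), ← Measure.restrict_apply' measurableSet_Ioc]
    apply measure_mono_ae
    filter_upwards [h2] with s hs _ using hs.ne'
  refine lt_of_lt_of_le ?_ h3
  rw [Real.volume_Ioc]
  simpa using hab

end RealAnalysis

/-! ### The Riemannian distance and locally Lipschitz curves -/

section Riemannian

variable (E : Type*) [NormedAddCommGroup E] [NormedSpace ℝ E]
  {S : Type*} [TopologicalSpace S] [ChartedSpace E S]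
  [RiemannianBundle (fun x : S ↦ TangentSpace 𝓘(ℝ, E) x)]

/-- The Riemannian distance as a real number. On a connected manifold the extended distance is finite,
so nothing is lost; see `ofReal_riemannianDist`. -/
def riemannianDist (x y : S) : ℝ := (riemannianEDist 𝓘(ℝ, E) x y).toReal

theorem riemannianDist_nonneg (x y : S) : 0 ≤ riemannianDist E x y := ENNReal.toReal_nonneg

theorem riemannianDist_self (x : S) : riemannianDist E x x = 0 := by
  simp [riemannianDist, riemannianEDist_self]

theorem riemannianDist_comm (x y : S) : riemannianDist E x y = riemannianDist E y x := by
  rw [riemannianDist, riemannianEDist_comm, riemannianDist]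

variable [IsManifold 𝓘(ℝ, E) 1 S] [PreconnectedSpace S]
  [IsContinuousRiemannianBundle E (fun x : S ↦ TangentSpace 𝓘(ℝ, E) x)]

theorem ofReal_riemannianDist (x y : S) :
    ENNReal.ofReal (riemannianDist E x y) = riemannianEDist 𝓘(ℝ, E) x y :=
  ENNReal.ofReal_toReal (riemannianEDist_ne_top x y)

theorem riemannianDist_triangle (x y z : S) :
    riemannianDist E x z ≤ riemannianDist E x y + riemannianDist E y z := by
  rw [riemannianDist, riemannianDist, riemannianDist,
    ← ENNReal.toReal_add (riemannianEDist_ne_top x y) (riemannianEDist_ne_top y z)]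
  exact ENNReal.toReal_mono (ENNReal.add_ne_top.2 ⟨riemannianEDist_ne_top x y,
    riemannianEDist_ne_top y z⟩) riemannianEDist_triangle

theorem abs_riemannianDist_sub_le (x y z : S) :
    |riemannianDist E x z - riemannianDist E x y| ≤ riemannianDist E y z := by
  have h1 := riemannianDist_triangle E x y z
  have h2 := riemannianDist_triangle E x z y
  rw [riemannianDist_comm E z y] at h2
  rw [abs_le]
  constructor <;> linarith

variable {E} in
theorem riemannianDist_le_iff {x y : S} {r : ℝ} (hr : 0 ≤ r) :
    riemannianDist E x y ≤ r ↔ riemannianEDist 𝓘(ℝ, E) x y ≤ ENNReal.ofReal r := by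
  rw [← ofReal_riemannianDist, ENNReal.ofReal_le_ofReal_iff hr]

theorem continuous_riemannianDist :
    Continuous (fun p : S × S ↦ riemannianDist E p.1 p.2) := by
  rw [continuous_iff_continuousAt]
  rintro ⟨x, y⟩
  rw [Metric.continuousAt_iff']
  intro ε hε
  have h : ∀ z : S, ∀ᶠ w in 𝓝 z, riemannianDist E z w < ε / 2 := fun z ↦ by
    filter_upwards [eventually_riemannianEDist_lt 𝓘(ℝ, E) z
      (ENNReal.ofReal_pos.2 (half_pos hε))] with w hw
    rw [← ofReal_riemannianDist] at hw
    exact (ENNReal.ofReal_lt_ofReal_iff (half_pos hε)).1 hw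
  rw [nhds_prod_eq]
  filter_upwards [(h x).prod_mk (h y)] with p hp
  have h1 := riemannianDist_triangle E p.1 x p.2
  have h2 := riemannianDist_triangle E x y p.2
  have h3 := riemannianDist_triangle E x p.1 y
  have h4 := riemannianDist_triangle E p.1 p.2 y
  rw [riemannianDist_comm E p.1 x] at h1
  rw [riemannianDist_comm E p.2 y] at h4
  rw [Real.dist_eq, abs_lt]
  constructor <;> linarith [hp.1, hp.2]

variable {E}

theorem IsLocallyLipschitzCurve.exists_lipschitzOnWith_riemannianDist {c : ℝ → S} {a b : ℝ}
    (hc : IsLocallyLipschitzCurve 𝓘(ℝ, E) c (Icc a b)) (x : S) :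
    ∃ K, LipschitzOnWith K (fun s ↦ riemannianDist E x (c s)) (Icc a b) := by
  apply LocallyLipschitzOn.exists_lipschitzOnWith_of_compact isCompact_Icc
  intro t ht
  obtain ⟨K, u, hu, hK⟩ := hc.2 t ht
  obtain ⟨C, hC⟩ := eventually_riemannianEDist_le_enorm_extChartAt_sub (E := E) (c t)
  obtain ⟨V, hV, hVC⟩ := mem_prod_same_iff.1 hC
  refine ⟨C * K, u ∩ c ⁻¹' V, inter_mem hu (hc.1 t ht hV), ?_⟩
  intro s hs s' hs'
  have h1 := hVC (mk_mem_prod hs'.2 hs.2)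
  have h2 := hK hs.1 hs'.1
  rw [edist_eq_enorm_sub] at h2
  calc edist (riemannianDist E x (c s)) (riemannianDist E x (c s'))
      = ENNReal.ofReal |riemannianDist E x (c s) - riemannianDist E x (c s')| := by
        rw [edist_dist, Real.dist_eq]
    _ ≤ riemannianEDist 𝓘(ℝ, E) (c s') (c s) := by
        rw [← ofReal_riemannianDist]
        exact ENNReal.ofReal_le_ofReal (abs_riemannianDist_sub_le E x _ _)
    _ ≤ C * (K * edist s s') := h1.trans (by gcongr)
    _ = _ := by push_cast; ring

/-- A locally Lipschitz curve is at least as long as the distance between its end points: if its speed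
is almost everywhere at most `τ'`, then this distance is at most `τ b - τ a`. The function
`s ↦ τ s - d(c a, c s)` has nonnegative derivative almost everywhere. -/
theorem riemannianDist_le_of_ae_norm_mfderiv_le {c : ℝ → S} {τ : ℝ → ℝ} {a b : ℝ} {K : ℝ≥0}
    (hab : a ≤ b) (hc : IsLocallyLipschitzCurve 𝓘(ℝ, E) c (Icc a b))
    (hτ : LipschitzOnWith K τ (Icc a b))
    (h : ∀ᵐ s ∂(volume.restrict (Icc a b)), MDifferentiableAt 𝓘(ℝ, ℝ) 𝓘(ℝ, E) c s ∧
      ∃ m, HasDerivAt τ m s ∧ ‖mfderiv 𝓘(ℝ, ℝ) 𝓘(ℝ, E) c s 1‖ ≤ m) :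
    riemannianDist E (c a) (c b) ≤ τ b - τ a := by
  obtain ⟨C, hC⟩ := hc.exists_lipschitzOnWith_riemannianDist (c a)
  have key := apply_le_of_ae_hasDerivAt_nonneg
    (h := fun s ↦ τ s - riemannianDist E (c a) (c s)) hab (hτ.sub hC) ?_
  · simp only [riemannianDist_self] at key
    linarith
  filter_upwards [h] with s ⟨hs, m, hm, hsm⟩ m' hm'
  have hD : HasDerivAt (fun t ↦ riemannianDist E (c a) (c t)) (m - m') s := by
    have h1 := hm.sub hm'
    rwa [show τ - (fun s ↦ τ s - riemannianDist E (c a) (c s)) =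
      fun t ↦ riemannianDist E (c a) (c t) by ext t; simp] at h1
  -- `m - m'` is the derivative of the distance, bounded by the speed
  suffices m - m' ≤ m by linarith
  refine le_trans (le_of_forall_gt_imp_ge_of_dense fun r hr ↦ ?_) hsm
  have hr0 : 0 ≤ r := (norm_nonneg _).trans hr.le
  lift r to ℝ≥0 using hr0 with r hr0'
  refine (le_abs_self _).trans (hD.le_of_lip' r.coe_nonneg ?_)
  filter_upwards [eventually_riemannianEDist_le_of_mdifferentiableAt hs hr] with t ht
  refine (abs_riemannianDist_sub_le E _ _ _).trans ?_
  rw [riemannianDist_le_iff (by positivity), ENNReal.ofReal_mul r.coe_nonneg, ofReal_norm,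
    ENNReal.ofReal_coe_nnreal]
  exact ht

variable [RegularSpace S]

omit [PreconnectedSpace S] in
/-- A curve which is `1`-Lipschitz for the Riemannian distance is locally Lipschitz in charts. -/
theorem continuousAt_and_lipschitzOnWith_of_riemannianEDist_le {f : ℝ → S}
    (hf : ∀ s t, riemannianEDist 𝓘(ℝ, E) (f s) (f t) ≤ ‖t - s‖ₑ) (t : ℝ) :
    ContinuousAt f t ∧ ∃ K : ℝ≥0, ∃ u ∈ 𝓝 t,
      LipschitzOnWith K (fun r ↦ extChartAt 𝓘(ℝ, E) (f t) (f r)) u := by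
  have hcont : ContinuousAt f t := by
    refine fun U hU ↦ mem_map.2 ?_
    obtain ⟨c, hc, hcU⟩ := setOfPred_riemannianEDist_lt_subset_nhds' 𝓘(ℝ, E) hU
    filter_upwards [Metric.eball_mem_nhds t hc] with s hs
    apply hcU
    refine (hf t s).trans_lt ?_
    rwa [← edist_eq_enorm_sub]
  refine ⟨hcont, ?_⟩
  obtain ⟨C, hC⟩ := eventually_enorm_extChartAt_sub_le (E := E) (f t)
  obtain ⟨V, hV, hVC⟩ := mem_prod_same_iff.1 hC
  refine ⟨C, f ⁻¹' V, hcont hV, ?_⟩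
  intro s hs s' hs'
  rw [edist_eq_enorm_sub, edist_eq_enorm_sub]
  exact (hVC (mk_mem_prod hs' hs)).trans (by gcongr; exact hf s' s)

omit [PreconnectedSpace S] in
theorem isLocallyLipschitzCurve_of_riemannianEDist_le {f : ℝ → S}
    (hf : ∀ s t, riemannianEDist 𝓘(ℝ, E) (f s) (f t) ≤ ‖t - s‖ₑ) (s : Set ℝ) :
    IsLocallyLipschitzCurve 𝓘(ℝ, E) f s := by
  refine ⟨fun t _ ↦ (continuousAt_and_lipschitzOnWith_of_riemannianEDist_le hf t).1.continuousWithinAt,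
    fun t _ ↦ ?_⟩
  obtain ⟨-, K, u, hu, hK⟩ := continuousAt_and_lipschitzOnWith_of_riemannianEDist_le hf t
  exact ⟨K, u, mem_nhdsWithin_of_mem_nhds hu, hK⟩

omit [PreconnectedSpace S] in
/-- Rademacher's theorem for curves which are `1`-Lipschitz for the Riemannian distance. -/
theorem ae_mdifferentiableAt_of_riemannianEDist_le [FiniteDimensional ℝ E] {f : ℝ → S}
    (hf : ∀ s t, riemannianEDist 𝓘(ℝ, E) (f s) (f t) ≤ ‖t - s‖ₑ) :
    ∀ᵐ s, MDifferentiableAt 𝓘(ℝ, ℝ) 𝓘(ℝ, E) f s := by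
  rw [ae_iff]
  apply measure_null_of_locally_null
  intro t _
  obtain ⟨hcont, K, u, hu, hK⟩ := continuousAt_and_lipschitzOnWith_of_riemannianEDist_le hf t
  have hsrc : ∀ᶠ s in 𝓝 t, f s ∈ (chartAt E (f t)).source :=
    hcont (chart_source_mem_nhds E (f t))
  obtain ⟨v, hv, hvo, htv⟩ := mem_nhds_iff.1 (inter_mem hu hsrc)
  refine ⟨{s | ¬ MDifferentiableAt 𝓘(ℝ, ℝ) 𝓘(ℝ, E) f s} ∩ v,
    inter_mem self_mem_nhdsWithin (mem_nhdsWithin_of_mem_nhds (hvo.mem_nhds htv)), ?_⟩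
  refine measure_mono_null ?_
    (ae_iff.1 (hK.mono (hv.trans inter_subset_left)).ae_differentiableWithinAt_of_mem)
  rintro s ⟨hs, hsv⟩ hd
  apply hs
  have hd1 : MDifferentiableAt 𝓘(ℝ, ℝ) 𝓘(ℝ, E) (fun r ↦ extChartAt 𝓘(ℝ, E) (f t) (f r)) s :=
    ((hd hsv).differentiableAt (hvo.mem_nhds hsv)).mdifferentiableAt
  have hsrc' : ∀ᶠ r in 𝓝 s, f r ∈ (extChartAt 𝓘(ℝ, E) (f t)).source := by
    filter_upwards [hvo.mem_nhds hsv] with r hr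
    rw [extChartAt_source]
    exact (hv hr).2
  have h2 : MDifferentiableAt 𝓘(ℝ, E) 𝓘(ℝ, E) (extChartAt 𝓘(ℝ, E) (f t)).symm
      (extChartAt 𝓘(ℝ, E) (f t) (f s)) := by
    have ht := (extChartAt 𝓘(ℝ, E) (f t)).map_source hsrc'.self_of_nhds
    exact ((contMDiffOn_extChartAt_symm (n := 1) (f t)).contMDiffAt
      ((isOpen_extChartAt_target (f t)).mem_nhds ht)).mdifferentiableAt one_ne_zero
  refine (h2.comp s hd1).congr_of_eventuallyEq ?_
  filter_upwards [hsrc'] with r hr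
  exact ((extChartAt 𝓘(ℝ, E) (f t)).left_inv hr).symm

end Riemannian

/-! ### Scaled product metrics as spacetimes -/

/-- A family of linear maps on a finite-dimensional space is smooth as soon as it is smooth on each
fixed vector. -/
theorem contMDiffAt_clm_of_apply {V W B HM M : Type*} [NormedAddCommGroup V] [NormedSpace ℝ V]
    [FiniteDimensional ℝ V] [NormedAddCommGroup W] [NormedSpace ℝ W]
    [NormedAddCommGroup B] [NormedSpace ℝ B] [TopologicalSpace HM] {J : ModelWithCorners ℝ B HM}
    [TopologicalSpace M] [ChartedSpace HM M] {n : ℕ∞ω} {L : M → V →L[ℝ] W} {p : M}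
    (h : ∀ v, ContMDiffAt J 𝓘(ℝ, W) n (fun q ↦ L q v) p) :
    ContMDiffAt J 𝓘(ℝ, V →L[ℝ] W) n L p := by
  let b := Module.finBasis ℝ V
  have hL : L = fun q ↦ ∑ i, ContinuousLinearMap.smulRightL ℝ V W
      (LinearMap.toContinuousLinearMap (b.coord i)) (L q (b i)) := by
    ext q v
    calc L q v = L q (∑ i, b.repr v i • b i) := by rw [b.sum_repr]
      _ = _ := by rw [map_sum]; simp
  rw [hL]
  exact contMDiffAt_finsetSum fun i _ ↦
    (ContinuousLinearMap.smulRightL ℝ V W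
      (LinearMap.toContinuousLinearMap (b.coord i))).contMDiff.contMDiffAt.comp p (h (b i))

section Product

variable {E : Type*} [NormedAddCommGroup E] [NormedSpace ℝ E]
  {S : Type*} [TopologicalSpace S] [ChartedSpace E S]

theorem dt_apply (p : ℝ × S) (v : TangentSpace (𝓘(ℝ, ℝ).prod 𝓘(ℝ, E)) p) :
    dt E p v = (show ℝ × E from v).1 := by
  rw [dt, mfderiv_fst]; rfl

theorem dproj_apply (p : ℝ × S) (v : TangentSpace (𝓘(ℝ, ℝ).prod 𝓘(ℝ, E)) p) :
    dproj E p v = (show ℝ × E from v).2 := by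
  rw [dproj, mfderiv_snd]; rfl

theorem timeField_eq (p : ℝ × S) : timeField E p = (show ℝ × E from (1, 0)) := by
  rw [timeField, mfderiv_prod_left]; rfl

@[simp] theorem dt_timeField (p : ℝ × S) : dt E p (timeField E p) = 1 := by
  rw [dt_apply, timeField_eq]

@[simp] theorem dproj_timeField (p : ℝ × S) : dproj E p (timeField E p) = 0 := by
  rw [dproj_apply, timeField_eq]; rfl

theorem eq_zero_of_dt_dproj {p : ℝ × S} {v : TangentSpace (𝓘(ℝ, ℝ).prod 𝓘(ℝ, E)) p}
    (h1 : dt E p v = 0) (h2 : dproj E p v = 0) : v = 0 := by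
  rw [dt_apply] at h1
  rw [dproj_apply] at h2
  exact Prod.ext h1 h2

theorem continuous_timeField [IsManifold 𝓘(ℝ, E) 1 S] :
    Continuous (fun p : ℝ × S ↦ (TotalSpace.mk' (ℝ × E) p (timeField E p) :
      TangentBundle (𝓘(ℝ, ℝ).prod 𝓘(ℝ, E)) (ℝ × S))) := by
  have h1 : Continuous (fun p : ℝ × S ↦ (⟨p.1, (1 : ℝ)⟩ : TangentBundle 𝓘(ℝ, ℝ) ℝ)) :=
    (tangentBundleModelSpaceHomeomorph (I := 𝓘(ℝ, ℝ))).symm.continuous.comp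
      (continuous_fst.prodMk (continuous_const (y := (1 : ℝ))))
  have h2 : Continuous (fun p : ℝ × S ↦ (⟨p.2, 0⟩ : TangentBundle 𝓘(ℝ, E) S)) :=
    (contMDiff_zeroSection (n := 0) (IB := 𝓘(ℝ, E)) ℝ (TangentSpace 𝓘(ℝ, E) : S → Type _)
      |>.continuous).comp continuous_snd
  have h3 := (contMDiff_equivTangentBundleProd_symm (n := 0) (I := 𝓘(ℝ, ℝ)) (I' := 𝓘(ℝ, E))
    (M := ℝ) (M' := S)).continuous.comp (h1.prodMk h2)
  refine h3.congr fun p ↦ ?_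
  rw [timeField_eq]
  rfl

variable [RiemannianBundle (fun x : S ↦ TangentSpace 𝓘(ℝ, E) x)]

variable (E) in
/-- The metric `-κ dt² ⊕ σ` on `ℝ × S`. For `κ = 1` this is the Lorentzian product metric; a larger `κ`
opens the light cones. It is written as a correction of `productMetric`, so that `κ = 1` gives it
back. -/
def scaledProductMetric (κ : ℝ) (p : ℝ × S) :
    TangentSpace (𝓘(ℝ, ℝ).prod 𝓘(ℝ, E)) p →L[ℝ]
      TangentSpace (𝓘(ℝ, ℝ).prod 𝓘(ℝ, E)) p →L[ℝ] ℝ :=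
  productMetric E p - (κ - 1) • (dt E p).smulRight (dt E p)

theorem scaledProductMetric_one : scaledProductMetric E (S := S) 1 = productMetric E := by
  ext p v w
  simp [scaledProductMetric]

theorem scaledProductMetric_apply (κ : ℝ) (p : ℝ × S)
    (v w : TangentSpace (𝓘(ℝ, ℝ).prod 𝓘(ℝ, E)) p) :
    scaledProductMetric E κ p v w =
      -(κ * (dt E p v * dt E p w)) + inner ℝ (dproj E p v) (dproj E p w) := by
  have : scaledProductMetric E κ p v w =
    productMetric E p v w - (κ - 1) * (dt E p v * dt E p w) := rfl
  rw [this, productMetric_apply]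
  ring

/-- Smoothness is checked on the local sections of the tangent bundle of `ℝ × S` that are constant in
a trivialization: the differentials of the projections map them to smooth families of tangent
vectors of `ℝ` and `S`. -/
theorem contMDiff_scaledProductMetric [FiniteDimensional ℝ E] [IsManifold 𝓘(ℝ, E) ∞ S]
    [IsContMDiffRiemannianBundle 𝓘(ℝ, E) ∞ E (fun x : S ↦ TangentSpace 𝓘(ℝ, E) x)] (κ : ℝ) :
    ContMDiff (𝓘(ℝ, ℝ).prod 𝓘(ℝ, E))
      ((𝓘(ℝ, ℝ).prod 𝓘(ℝ, E)).prod 𝓘(ℝ, (ℝ × E) →L[ℝ] (ℝ × E) →L[ℝ] ℝ)) ∞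
      (fun p : ℝ × S ↦ TotalSpace.mk' ((ℝ × E) →L[ℝ] (ℝ × E) →L[ℝ] ℝ)
        (E := fun p : ℝ × S ↦ TangentSpace (𝓘(ℝ, ℝ).prod 𝓘(ℝ, E)) p →L[ℝ]
          TangentSpace (𝓘(ℝ, ℝ).prod 𝓘(ℝ, E)) p →L[ℝ] ℝ) p (scaledProductMetric E κ p)) := by
  intro p₀
  rw [contMDiffAt_hom_bundle]
  refine ⟨contMDiffAt_id, ?_⟩
  -- the local sections `e.symm p v` with `v` fixed are smooth at `p₀`
  let e := trivializationAt (ℝ × E)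
    (TangentSpace (𝓘(ℝ, ℝ).prod 𝓘(ℝ, E)) : ℝ × S → Type _) p₀
  have hbase : ∀ᶠ p in 𝓝 p₀, p ∈ e.baseSet :=
    e.open_baseSet.mem_nhds (FiberBundle.mem_baseSet_trivializationAt' p₀)
  have hσ : ∀ v : ℝ × E, ContMDiffAt (𝓘(ℝ, ℝ).prod 𝓘(ℝ, E)) (𝓘(ℝ, ℝ).prod 𝓘(ℝ, E)).tangent ∞
      (fun p ↦ (⟨p, e.symm p v⟩ : TangentBundle (𝓘(ℝ, ℝ).prod 𝓘(ℝ, E)) (ℝ × S))) p₀ := by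
    intro v
    refine (contMDiffAt_section (F := ℝ × E)
      (E := (TangentSpace (𝓘(ℝ, ℝ).prod 𝓘(ℝ, E)) : ℝ × S → Type _)) p₀).2 ?_
    refine (contMDiffAt_const (c := v)).congr_of_eventuallyEq ?_
    filter_upwards [hbase] with p hp
    rw [e.apply_mk_symm hp]
  have hd : ∀ v : ℝ × E, ContMDiffAt (𝓘(ℝ, ℝ).prod 𝓘(ℝ, E)) 𝓘(ℝ, ℝ) ∞
      (fun p ↦ dt E p (e.symm p v)) p₀ := by
    intro v
    have h1 := ((contMDiff_fst (I := 𝓘(ℝ, ℝ)) (J := 𝓘(ℝ, E)) (M := ℝ) (N := S)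
      (n := ∞)).contMDiff_tangentMap le_rfl).contMDiffAt.comp p₀ (hσ v)
    exact (contMDiff_snd_tangentBundle_modelSpace ℝ 𝓘(ℝ, ℝ)).contMDiffAt.comp p₀ h1
  have hp : ∀ v : ℝ × E, ContMDiffAt (𝓘(ℝ, ℝ).prod 𝓘(ℝ, E)) 𝓘(ℝ, E).tangent ∞
      (fun p : ℝ × S ↦ (⟨p.2, dproj E p (e.symm p v)⟩ :
        TotalSpace E (TangentSpace 𝓘(ℝ, E) : S → Type _))) p₀ := by
    intro v
    exact ((contMDiff_snd (I := 𝓘(ℝ, ℝ)) (J := 𝓘(ℝ, E)) (M := ℝ) (N := S)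
      (n := ∞)).contMDiff_tangentMap le_rfl).contMDiffAt.comp p₀ (hσ v)
  refine contMDiffAt_clm_of_apply fun v ↦ contMDiffAt_clm_of_apply fun w ↦ ?_
  have hmain : ContMDiffAt (𝓘(ℝ, ℝ).prod 𝓘(ℝ, E)) 𝓘(ℝ, ℝ) ∞
      (fun p : ℝ × S ↦ -(κ * (dt E p (e.symm p v) * dt E p (e.symm p w))) +
        inner ℝ (dproj E p (e.symm p v)) (dproj E p (e.symm p w))) p₀ :=
    ((contMDiffAt_const (c := κ)).mul ((hd v).mul (hd w))).neg.add
      (ContMDiffAt.inner_bundle (n := ∞) (IB := 𝓘(ℝ, E)) (F := E) (b := Prod.snd)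
        (E := fun x : S ↦ TangentSpace 𝓘(ℝ, E) x) (hp v) (hp w))
  refine hmain.congr_of_eventuallyEq ?_
  filter_upwards [hbase] with p hpb
  rw [← scaledProductMetric_apply]
  refine (inCoordinates_apply_eq₂ (𝕜 := ℝ) (F₁ := ℝ × E) (F₂ := ℝ × E) (F₃ := ℝ)
    (E₁ := (TangentSpace (𝓘(ℝ, ℝ).prod 𝓘(ℝ, E)) : ℝ × S → Type _))
    (E₂ := (TangentSpace (𝓘(ℝ, ℝ).prod 𝓘(ℝ, E)) : ℝ × S → Type _))
    (E₃ := Bundle.Trivial (ℝ × S) ℝ) (ϕ := scaledProductMetric E κ p) hpb hpb (by trivial)).trans ?_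
  rw [Trivialization.linearMapAt_apply]
  exact if_pos (by trivial)

theorem isSpacetime_scaledProductMetric [FiniteDimensional ℝ E] [T2Space S] [ParacompactSpace S]
    [ConnectedSpace S] [IsManifold 𝓘(ℝ, E) ∞ S]
    [IsContMDiffRiemannianBundle 𝓘(ℝ, E) ∞ E (fun x : S ↦ TangentSpace 𝓘(ℝ, E) x)]
    [IsContinuousRiemannianBundle E (fun x : S ↦ TangentSpace 𝓘(ℝ, E) x)]
    {κ : ℝ} (hκ : 0 < κ) :
    IsSpacetime (𝓘(ℝ, ℝ).prod 𝓘(ℝ, E)) (scaledProductMetric E (S := S) κ) (timeField E) where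
  hausdorff := inferInstance
  paracompact := by
    -- a product of paracompact spaces need not be paracompact, but this one is pseudometrizable
    let _ : PseudoEMetricSpace S := PseudoEMetricSpace.ofRiemannianMetric 𝓘(ℝ, E) S
    infer_instance
  connected := inferInstance
  smooth := contMDiff_scaledProductMetric κ
  symm p v w := by
    rw [scaledProductMetric_apply, scaledProductMetric_apply, real_inner_comm,
      mul_comm (dt E p v)]
  nondegenerate p v h := by
    have h1 := h (timeField E p)
    rw [scaledProductMetric_apply, dt_timeField, dproj_timeField, inner_zero_right, mul_one,
      add_zero, neg_eq_zero, mul_eq_zero, or_iff_right hκ.ne'] at h1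
    have h2 := h v
    rw [scaledProductMetric_apply, h1, mul_zero, mul_zero, neg_zero, zero_add,
      inner_self_eq_zero] at h2
    exact eq_zero_of_dt_dproj h1 h2
  index_one p := by
    constructor
    · refine ⟨Submodule.span ℝ {timeField E p}, finrank_span_singleton ?_, ?_⟩
      · intro h0
        have := dt_timeField (E := E) p
        rw [h0, map_zero] at this
        exact zero_ne_one this
      · intro v hv hv0
        obtain ⟨a, rfl⟩ := Submodule.mem_span_singleton.1 hv
        have ha : a ≠ 0 := by rintro rfl; exact hv0 (zero_smul _ _)
        rw [scaledProductMetric_apply, map_smul, map_smul, dt_timeField, dproj_timeField,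
          smul_zero, inner_zero_right, smul_eq_mul, mul_one, add_zero, neg_lt_zero]
        have := mul_self_pos.2 ha
        positivity
    · rintro k ⟨W, rfl, hW⟩
      -- the metric is nonnegative on the kernel of `dt`, hence `dt` is injective on `W`
      let f : W →ₗ[ℝ] ℝ := (dt E p).toLinearMap.domRestrict W
      have hf : Function.Injective f := by
        rw [injective_iff_map_eq_zero]
        rintro ⟨w, hw⟩ h0
        by_contra hne
        have h1 := hW w hw fun h ↦ hne (Subtype.ext h)
        have h0' : dt E p w = 0 := h0
        rw [scaledProductMetric_apply, h0', mul_zero, mul_zero, neg_zero, zero_add] at h1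
        exact h1.not_ge real_inner_self_nonneg
      simpa using LinearMap.finrank_le_finrank_of_injective hf
  continuous_orientation := continuous_timeField
  timelike_orientation p := by
    rw [scaledProductMetric_apply, dt_timeField, dproj_timeField, inner_zero_right]
    linarith

end Product

/-! ### Causal curves of the Lorentzian product -/

section ProductCurves

variable {E : Type*} [NormedAddCommGroup E] [NormedSpace ℝ E]
  {S : Type*} [TopologicalSpace S] [ChartedSpace E S]

theorem isLocallyLipschitzCurve_of_contMDiff [IsManifold 𝓘(ℝ, E) 1 S] {c : ℝ → S}
    (hc : ContMDiff 𝓘(ℝ, ℝ) 𝓘(ℝ, E) 1 c) (s : Set ℝ) :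
    IsLocallyLipschitzCurve 𝓘(ℝ, E) c s := by
  refine ⟨hc.continuous.continuousOn, fun t _ ↦ ?_⟩
  have h1 : ContMDiffAt 𝓘(ℝ, ℝ) 𝓘(ℝ, E) 1 (fun r ↦ extChartAt 𝓘(ℝ, E) (c t) (c r)) t :=
    (contMDiffAt_extChartAt (n := 1) (x := c t)).comp t (hc t)
  obtain ⟨K, u, hu, hK⟩ := (contMDiffAt_iff_contDiffAt.1 h1).exists_lipschitzOnWith
  exact ⟨K, u, mem_nhdsWithin_of_mem_nhds hu, hK⟩

theorem extChartAt_prod_apply (p q : ℝ × S) :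
    extChartAt (𝓘(ℝ, ℝ).prod 𝓘(ℝ, E)) p q = (q.1, extChartAt 𝓘(ℝ, E) p.2 q.2) := by
  rw [extChartAt_prod]; rfl

theorem IsLocallyLipschitzCurve.snd {γ : ℝ → ℝ × S} {s : Set ℝ}
    (hγ : IsLocallyLipschitzCurve (𝓘(ℝ, ℝ).prod 𝓘(ℝ, E)) γ s) :
    IsLocallyLipschitzCurve 𝓘(ℝ, E) (fun r ↦ (γ r).2) s := by
  refine ⟨continuous_snd.comp_continuousOn hγ.1, fun t ht ↦ ?_⟩
  obtain ⟨K, u, hu, hK⟩ := hγ.2 t ht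
  refine ⟨K, u, hu, ?_⟩
  have := (LipschitzWith.prod_snd.comp_lipschitzOnWith hK)
  simpa only [one_mul, Function.comp_def, extChartAt_prod_apply] using this

theorem IsLocallyLipschitzCurve.exists_lipschitzOnWith_fst {γ : ℝ → ℝ × S} {a b : ℝ}
    (hγ : IsLocallyLipschitzCurve (𝓘(ℝ, ℝ).prod 𝓘(ℝ, E)) γ (Icc a b)) :
    ∃ K, LipschitzOnWith K (fun r ↦ (γ r).1) (Icc a b) := by
  apply LocallyLipschitzOn.exists_lipschitzOnWith_of_compact isCompact_Icc
  intro t ht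
  obtain ⟨K, u, hu, hK⟩ := hγ.2 t ht
  refine ⟨K, u, hu, ?_⟩
  have := (LipschitzWith.prod_fst.comp_lipschitzOnWith hK)
  simpa only [one_mul, Function.comp_def, extChartAt_prod_apply] using this

theorem IsLocallyLipschitzCurve.prodMk {τ : ℝ → ℝ} {c : ℝ → S} {s : Set ℝ} {K : ℝ≥0}
    (hτ : LipschitzOnWith K τ s) (hc : IsLocallyLipschitzCurve 𝓘(ℝ, E) c s) :
    IsLocallyLipschitzCurve (𝓘(ℝ, ℝ).prod 𝓘(ℝ, E)) (fun r ↦ (τ r, c r)) s := by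
  refine ⟨hτ.continuousOn.prodMk hc.1, fun t ht ↦ ?_⟩
  obtain ⟨C, u, hu, hC⟩ := hc.2 t ht
  refine ⟨max K C, u ∩ s, inter_mem hu self_mem_nhdsWithin, ?_⟩
  have := (hτ.mono (inter_subset_right (s := u))).prodMk (hC.mono (inter_subset_left (t := s)))
  simpa only [extChartAt_prod_apply] using this

theorem hasDerivAt_fst_of_mdifferentiableAt {γ : ℝ → ℝ × S} {s : ℝ}
    (hγ : MDifferentiableAt 𝓘(ℝ, ℝ) (𝓘(ℝ, ℝ).prod 𝓘(ℝ, E)) γ s) :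
    HasDerivAt (fun r ↦ (γ r).1)
      (dt E (γ s) (mfderiv 𝓘(ℝ, ℝ) (𝓘(ℝ, ℝ).prod 𝓘(ℝ, E)) γ s (1 : ℝ))) s := by
  have h1 : HasMFDerivAt (𝓘(ℝ, ℝ).prod 𝓘(ℝ, E)) 𝓘(ℝ, ℝ) (Prod.fst : ℝ × S → ℝ) (γ s)
    (dt E (γ s)) := mdifferentiableAt_fst.hasMFDerivAt
  have h2 : HasFDerivAt (E := ℝ) (F := ℝ) (fun r ↦ (γ r).1)
    ((dt E (γ s)).comp (mfderiv 𝓘(ℝ, ℝ) (𝓘(ℝ, ℝ).prod 𝓘(ℝ, E)) γ s)) s :=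
    (h1.comp s hγ.hasMFDerivAt).hasFDerivAt
  exact h2.hasDerivAt

theorem hasMFDerivAt_snd_of_mdifferentiableAt {γ : ℝ → ℝ × S} {s : ℝ}
    (hγ : MDifferentiableAt 𝓘(ℝ, ℝ) (𝓘(ℝ, ℝ).prod 𝓘(ℝ, E)) γ s) :
    HasMFDerivAt 𝓘(ℝ, ℝ) 𝓘(ℝ, E) (fun r ↦ (γ r).2) s
      ((dproj E (γ s)).comp (mfderiv 𝓘(ℝ, ℝ) (𝓘(ℝ, ℝ).prod 𝓘(ℝ, E)) γ s)) := by
  have h1 : HasMFDerivAt (𝓘(ℝ, ℝ).prod 𝓘(ℝ, E)) 𝓘(ℝ, E) (Prod.snd : ℝ × S → S) (γ s)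
    (dproj E (γ s)) := mdifferentiableAt_snd.hasMFDerivAt
  exact h1.comp s hγ.hasMFDerivAt

variable [RiemannianBundle (fun x : S ↦ TangentSpace 𝓘(ℝ, E) x)]

theorem isFutureCausal_scaledProductMetric_iff {κ : ℝ} {p : ℝ × S}
    {v : TangentSpace (𝓘(ℝ, ℝ).prod 𝓘(ℝ, E)) p} (hκ : 0 < κ) :
    IsFutureCausal (𝓘(ℝ, ℝ).prod 𝓘(ℝ, E)) (scaledProductMetric E κ) (timeField E) v ↔
      0 < dt E p v ∧ ‖dproj E p v‖ ^ 2 ≤ κ * dt E p v ^ 2 := by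
  have h0 : 0 < dt E p v → v ≠ 0 := by
    rintro h rfl
    rw [map_zero] at h
    exact lt_irrefl _ h
  simp only [IsFutureCausal, scaledProductMetric_apply, real_inner_self_eq_norm_sq, dt_timeField,
    dproj_timeField, inner_zero_right, mul_one, add_zero, neg_lt_zero]
  constructor
  · rintro ⟨-, h1, h2⟩
    exact ⟨pos_of_mul_pos_right h2 hκ.le, by nlinarith⟩
  · rintro ⟨h1, h2⟩
    exact ⟨h0 h1, by nlinarith, by positivity⟩

theorem isFutureCausal_productMetric_iff {p : ℝ × S}
    {v : TangentSpace (𝓘(ℝ, ℝ).prod 𝓘(ℝ, E)) p} :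
    IsFutureCausal (𝓘(ℝ, ℝ).prod 𝓘(ℝ, E)) (productMetric E) (timeField E) v ↔
      0 < dt E p v ∧ ‖dproj E p v‖ ≤ dt E p v := by
  rw [← scaledProductMetric_one, isFutureCausal_scaledProductMetric_iff zero_lt_one, one_mul]
  refine and_congr_right fun h ↦ ?_
  exact pow_le_pow_iff_left₀ (norm_nonneg _) h.le two_ne_zero

omit [RiemannianBundle (fun x : S ↦ TangentSpace 𝓘(ℝ, E) x)] in
/-- At a point where `γ` is not differentiable `mfderiv` is `0`, so a velocity with nonzero time
component is a genuine one. -/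
theorem mdifferentiableAt_of_dt_ne_zero {γ : ℝ → ℝ × S} {s : ℝ}
    (h : dt E (γ s) (mfderiv 𝓘(ℝ, ℝ) (𝓘(ℝ, ℝ).prod 𝓘(ℝ, E)) γ s (1 : ℝ)) ≠ 0) :
    MDifferentiableAt 𝓘(ℝ, ℝ) (𝓘(ℝ, ℝ).prod 𝓘(ℝ, E)) γ s := by
  by_contra hn
  apply h
  rw [mfderiv_zero_of_not_mdifferentiableAt hn]
  exact map_zero (dt E (γ s))

/-- Time increases strictly along future causal curves of `-κ dt² ⊕ σ`, for every `κ > 0`. -/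
theorem IsFutureCausalCurve.fst_lt_fst {κ : ℝ} (hκ : 0 < κ) {γ : ℝ → ℝ × S} {a b : ℝ}
    (hγ : IsFutureCausalCurve (𝓘(ℝ, ℝ).prod 𝓘(ℝ, E)) (scaledProductMetric E κ) (timeField E)
      γ a b) : (γ a).1 < (γ b).1 := by
  obtain ⟨K, hK⟩ := hγ.lipschitz.exists_lipschitzOnWith_fst
  refine apply_lt_of_ae_hasDerivAt_pos hγ.lt hK ?_
  filter_upwards [hγ.causal] with s hs m hm
  have h1 := ((isFutureCausal_scaledProductMetric_iff hκ).1 hs).1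
  rwa [hm.unique (hasDerivAt_fst_of_mdifferentiableAt (mdifferentiableAt_of_dt_ne_zero h1.ne'))]

theorem isCausal_scaledProductMetric {κ : ℝ} (hκ : 0 < κ) :
    IsCausal (𝓘(ℝ, ℝ).prod 𝓘(ℝ, E)) (scaledProductMetric E (S := S) κ) (timeField E) := by
  rintro p ⟨γ, a, b, hγ, ha, hb⟩
  have := hγ.fst_lt_fst hκ
  rw [ha, hb] at this
  exact lt_irrefl _ this

theorem isTimeFunction_fst :
    IsTimeFunction (𝓘(ℝ, ℝ).prod 𝓘(ℝ, E)) (productMetric E (S := S)) (timeField E) Prod.fst := by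
  refine ⟨continuous_fst, ?_⟩
  rintro p q (⟨γ, a, b, hγ, rfl, rfl⟩ | rfl) hne
  · rw [← scaledProductMetric_one] at hγ
    exact hγ.fst_lt_fst zero_lt_one
  · exact absurd rfl hne

theorem isFutureCausalCurve_prodMk {τ : ℝ → ℝ} {c : ℝ → S} {a b : ℝ} {K : ℝ≥0} (hab : a < b)
    (hτ : LipschitzOnWith K τ (Icc a b)) (hc : IsLocallyLipschitzCurve 𝓘(ℝ, E) c (Icc a b))
    (h : ∀ᵐ s ∂(volume.restrict (Icc a b)), MDifferentiableAt 𝓘(ℝ, ℝ) 𝓘(ℝ, E) c s ∧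
      ∃ m, HasDerivAt τ m s ∧ 0 < m ∧ ‖mfderiv 𝓘(ℝ, ℝ) 𝓘(ℝ, E) c s 1‖ ≤ m) :
    IsFutureCausalCurve (𝓘(ℝ, ℝ).prod 𝓘(ℝ, E)) (productMetric E) (timeField E)
      (fun s ↦ (τ s, c s)) a b := by
  refine ⟨hab, .prodMk hτ hc, ?_⟩
  filter_upwards [h] with s ⟨hs, m, hm, hm0, hsm⟩
  have hd : MDifferentiableAt 𝓘(ℝ, ℝ) (𝓘(ℝ, ℝ).prod 𝓘(ℝ, E)) (fun s ↦ (τ s, c s)) s :=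
    hm.differentiableAt.mdifferentiableAt.prodMk hs
  rw [isFutureCausal_productMetric_iff,
    (hasDerivAt_fst_of_mdifferentiableAt hd).unique hm]
  have h2 := (hasMFDerivAt_snd_of_mdifferentiableAt hd).mfderiv
  refine ⟨hm0, ?_⟩
  have h3 : ‖mfderiv 𝓘(ℝ, ℝ) 𝓘(ℝ, E) (fun r ↦ c r) s 1‖ ≤ m := hsm
  rw [h2] at h3
  exact h3

theorem isPastCausalCurve_prodMk {τ : ℝ → ℝ} {c : ℝ → S} {a b : ℝ} {K : ℝ≥0} (hab : a < b)
    (hτ : LipschitzOnWith K τ (Icc a b)) (hc : IsLocallyLipschitzCurve 𝓘(ℝ, E) c (Icc a b))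
    (h : ∀ᵐ s ∂(volume.restrict (Icc a b)), MDifferentiableAt 𝓘(ℝ, ℝ) 𝓘(ℝ, E) c s ∧
      ∃ m, HasDerivAt τ (-m) s ∧ 0 < m ∧ ‖mfderiv 𝓘(ℝ, ℝ) 𝓘(ℝ, E) c s 1‖ ≤ m) :
    IsPastCausalCurve (𝓘(ℝ, ℝ).prod 𝓘(ℝ, E)) (productMetric E) (timeField E)
      (fun s ↦ (τ s, c s)) a b := by
  refine ⟨hab, .prodMk hτ hc, ?_⟩
  filter_upwards [h] with s ⟨hs, m, hm, hm0, hsm⟩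
  have hd : MDifferentiableAt 𝓘(ℝ, ℝ) (𝓘(ℝ, ℝ).prod 𝓘(ℝ, E)) (fun s ↦ (τ s, c s)) s :=
    hm.differentiableAt.mdifferentiableAt.prodMk hs
  rw [isFutureCausal_productMetric_iff, map_neg, map_neg, norm_neg,
    (hasDerivAt_fst_of_mdifferentiableAt hd).unique hm, neg_neg]
  have h2 := (hasMFDerivAt_snd_of_mdifferentiableAt hd).mfderiv
  refine ⟨hm0, ?_⟩
  have h3 : ‖mfderiv 𝓘(ℝ, ℝ) 𝓘(ℝ, E) (fun r ↦ c r) s 1‖ ≤ m := hsm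
  rw [h2] at h3
  exact h3

variable [IsManifold 𝓘(ℝ, E) 1 S] [PreconnectedSpace S]
  [IsContinuousRiemannianBundle E (fun x : S ↦ TangentSpace 𝓘(ℝ, E) x)]

theorem IsFutureCausalCurve.riemannianDist_le {γ : ℝ → ℝ × S} {a b : ℝ}
    (hγ : IsFutureCausalCurve (𝓘(ℝ, ℝ).prod 𝓘(ℝ, E)) (productMetric E) (timeField E) γ a b) :
    riemannianDist E (γ a).2 (γ b).2 ≤ (γ b).1 - (γ a).1 := by
  obtain ⟨K, hK⟩ := hγ.lipschitz.exists_lipschitzOnWith_fst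
  refine riemannianDist_le_of_ae_norm_mfderiv_le hγ.lt.le hγ.lipschitz.snd hK ?_
  filter_upwards [hγ.causal] with s hs
  obtain ⟨h1, h2⟩ := isFutureCausal_productMetric_iff.1 hs
  have hd := mdifferentiableAt_of_dt_ne_zero h1.ne'
  refine ⟨(hasMFDerivAt_snd_of_mdifferentiableAt hd).mdifferentiableAt, _,
    hasDerivAt_fst_of_mdifferentiableAt hd, ?_⟩
  rw [(hasMFDerivAt_snd_of_mdifferentiableAt hd).mfderiv]
  exact h2

theorem IsPastCausalCurve.riemannianDist_le {γ : ℝ → ℝ × S} {a b : ℝ}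
    (hγ : IsPastCausalCurve (𝓘(ℝ, ℝ).prod 𝓘(ℝ, E)) (productMetric E) (timeField E) γ a b) :
    riemannianDist E (γ a).2 (γ b).2 ≤ (γ a).1 - (γ b).1 := by
  obtain ⟨K, hK⟩ := hγ.lipschitz.exists_lipschitzOnWith_fst
  have key := riemannianDist_le_of_ae_norm_mfderiv_le (E := E) (τ := fun s ↦ -(γ s).1)
    hγ.lt.le hγ.lipschitz.snd hK.neg ?_
  · linarith
  filter_upwards [hγ.causal] with s hs
  obtain ⟨h1, h2⟩ := isFutureCausal_productMetric_iff.1 hs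
  rw [map_neg] at h1 h2
  rw [map_neg, norm_neg] at h2
  have hd := mdifferentiableAt_of_dt_ne_zero (neg_pos.1 h1).ne
  refine ⟨(hasMFDerivAt_snd_of_mdifferentiableAt hd).mdifferentiableAt, _,
    (hasDerivAt_fst_of_mdifferentiableAt hd).neg, ?_⟩
  rw [(hasMFDerivAt_snd_of_mdifferentiableAt hd).mfderiv]
  exact h2

theorem CausalLE.riemannianDist_le {p q : ℝ × S}
    (h : CausalLE (𝓘(ℝ, ℝ).prod 𝓘(ℝ, E)) (productMetric E) (timeField E) p q) :
    riemannianDist E p.2 q.2 ≤ q.1 - p.1 := by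
  obtain ⟨γ, a, b, hγ, rfl, rfl⟩ | rfl := h
  · exact hγ.riemannianDist_le
  · rw [riemannianDist_self, sub_self]

/-- Two points at distance less than `L` are joined by a `C^1` curve `c` on `[0, 1]` together with a
`C^1` majorant `l` of its arc length, strictly increasing, and normalized to `l 1 = L`. With
`t = ± l` up to constants the curve `(t, c)` of the Lorentzian product is causal. -/
theorem exists_contMDiff_of_riemannianDist_lt {x y : S} {L : ℝ} (h : riemannianDist E x y < L) :
    ∃ (c : ℝ → S) (l l' : ℝ → ℝ), ContMDiff 𝓘(ℝ, ℝ) 𝓘(ℝ, E) 1 c ∧ c 0 = x ∧ c 1 = y ∧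
      Continuous l' ∧ (∀ s, HasDerivAt l (l' s) s) ∧ (∀ s, 0 < l' s) ∧
      (∀ s, ‖mfderiv 𝓘(ℝ, ℝ) 𝓘(ℝ, E) c s 1‖ ≤ l' s) ∧ l 0 = 0 ∧ l 1 = L := by
  have hL : 0 < L := (riemannianDist_nonneg E x y).trans_lt h
  have h' : riemannianEDist 𝓘(ℝ, E) x y < ENNReal.ofReal L := by
    rw [← ofReal_riemannianDist]
    exact (ENNReal.ofReal_lt_ofReal_iff hL).2 h
  obtain ⟨c, c0, c1, hc, hcL, -, -⟩ := exists_lt_locally_constant_of_riemannianEDist_lt h'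
    (zero_lt_one (α := ℝ))
  let n : ℝ → ℝ := fun s ↦ ‖mfderiv 𝓘(ℝ, ℝ) 𝓘(ℝ, E) c s 1‖
  have hn : Continuous n := continuous_iff_continuousAt.2 fun s ↦ continuousAt_norm_mfderiv (hc s)
  have hlen : pathELength 𝓘(ℝ, E) c 0 1 = ENNReal.ofReal (∫ s in (0 : ℝ)..1, n s) := by
    rw [pathELength_eq_lintegral_mfderiv_Icc, intervalIntegral.integral_of_le zero_le_one,
      ← integral_Icc_eq_integral_Ioc,
      ofReal_integral_eq_lintegral_ofReal (hn.integrableOn_Icc)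
        (ae_of_all _ fun s ↦ norm_nonneg _)]
    simp only [n, ofReal_norm]
  rw [hlen, ENNReal.ofReal_lt_ofReal_iff hL] at hcL
  -- the excess of `L` over the length is spread uniformly, which makes `l` strictly increasing
  -- also where `c` stands still
  set δ := L - ∫ s in (0 : ℝ)..1, n s with hδ
  have hδ0 : 0 < δ := sub_pos.2 hcL
  refine ⟨c, fun t ↦ ∫ s in (0 : ℝ)..t, (n s + δ), fun s ↦ n s + δ, hc, c0, c1, by fun_prop,
    fun s ↦ ?_, fun s ↦ ?_, fun s ↦ ?_, by simp, ?_⟩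
  · exact intervalIntegral.integral_hasDerivAt_right (by
      apply Continuous.intervalIntegrable; fun_prop)
      (Continuous.stronglyMeasurableAtFilter (by fun_prop) _ _) (by fun_prop)
  · exact add_pos_of_nonneg_of_pos (norm_nonneg _) hδ0
  · exact le_add_of_nonneg_right hδ0.le
  · simp only
    rw [intervalIntegral.integral_add (hn.intervalIntegrable _ _) (by simp)]
    simp [hδ]

end ProductCurves

/-! ### Stable causality and the null distance -/

theorem abs_sub_le_nullLength {M : Type*} (τ : M → ℝ) (γ : ℝ → M) (k : ℕ) (a : ℕ → ℝ) :
    |τ (γ (a k)) - τ (γ (a 0))| ≤ nullLength τ γ k a := by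
  rw [nullLength, ← Finset.sum_range_sub (fun i ↦ τ (γ (a i)))]
  exact Finset.abs_sum_le_sum_abs _ _

theorem exists_lipschitzOnWith_Icc_of_hasDerivAt {l l' : ℝ → ℝ} (hl' : Continuous l')
    (hl : ∀ s, HasDerivAt l (l' s) s) (a b : ℝ) : ∃ K, LipschitzOnWith K l (Icc a b) := by
  have h : ContDiff ℝ 1 l := by
    rw [contDiff_one_iff_deriv]
    refine ⟨fun s ↦ (hl s).differentiableAt, ?_⟩
    rwa [show deriv l = l' from funext fun s ↦ (hl s).deriv]
  exact h.contDiffOn.exists_lipschitzOnWith (by decide) (convex_Icc _ _) isCompact_Icc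

section Product

variable {E : Type*} [NormedAddCommGroup E] [NormedSpace ℝ E]
  {S : Type*} [TopologicalSpace S] [ChartedSpace E S]
  [RiemannianBundle (fun x : S ↦ TangentSpace 𝓘(ℝ, E) x)]

/-- The wider cones are those of `-4 dt² ⊕ σ`, for which `t` is still strictly increasing along
causal curves. -/
theorem isStablyCausal_productMetric [FiniteDimensional ℝ E] [T2Space S] [ParacompactSpace S]
    [ConnectedSpace S] [IsManifold 𝓘(ℝ, E) ∞ S]
    [IsContMDiffRiemannianBundle 𝓘(ℝ, E) ∞ E (fun x : S ↦ TangentSpace 𝓘(ℝ, E) x)]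
    [IsContinuousRiemannianBundle E (fun x : S ↦ TangentSpace 𝓘(ℝ, E) x)] :
    IsStablyCausal (𝓘(ℝ, ℝ).prod 𝓘(ℝ, E)) (productMetric E (S := S)) (timeField E) := by
  refine ⟨scaledProductMetric E 4, timeField E, isSpacetime_scaledProductMetric (by norm_num),
    fun p v hv ↦ ?_, isCausal_scaledProductMetric (by norm_num)⟩
  obtain ⟨h1, h2⟩ := isFutureCausal_productMetric_iff.1 hv
  rw [IsFutureTimelike, scaledProductMetric_apply, scaledProductMetric_apply,
    real_inner_self_eq_norm_sq, dt_timeField, dproj_timeField, inner_zero_right]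
  constructor
  · nlinarith [norm_nonneg (dproj E p v)]
  · linarith

variable [IsManifold 𝓘(ℝ, E) 1 S] [PreconnectedSpace S]
  [IsContinuousRiemannianBundle E (fun x : S ↦ TangentSpace 𝓘(ℝ, E) x)]

/-- The chronological part of the causal relation. No completeness is needed. -/
theorem existsCausalCurve_of_riemannianDist_lt {p q : ℝ × S}
    (h : riemannianDist E p.2 q.2 < q.1 - p.1) :
    ExistsCausalCurve (𝓘(ℝ, ℝ).prod 𝓘(ℝ, E)) (productMetric E) (timeField E) p q := by
  obtain ⟨c, l, l', hc, c0, c1, hl', hl, hpos, hle, l0, l1⟩ :=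
    exists_contMDiff_of_riemannianDist_lt h
  obtain ⟨K, hK⟩ := exists_lipschitzOnWith_Icc_of_hasDerivAt hl'
    (fun s ↦ (hl s).const_add p.1) 0 1
  refine ⟨fun s ↦ (p.1 + l s, c s), 0, 1, ?_, ?_, ?_⟩
  · refine isFutureCausalCurve_prodMk zero_lt_one hK
      (isLocallyLipschitzCurve_of_contMDiff hc _) (ae_of_all _ fun s ↦ ?_)
    exact ⟨(hc s).mdifferentiableAt one_ne_zero, l' s, (hl s).const_add p.1, hpos s, hle s⟩
  · simp [l0, c0]
  · simp [l1, c1]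

/-- The upper bound for the null distance. Along an almost shortest curve `c` from `p.2` to `q.2`, with
arc length majorant `l` normalized to `l 1 = r`, the time component first increases and then
decreases, each at the rate `l'`; it turns at the parameter `s₀` with `l s₀ = (r + (q.1 - p.1)) / 2`,
so that it ends at `q.1`. The null length is `r`. -/
theorem nullEDist_le_of_lt {p q : ℝ × S} {r : ℝ} (h1 : |q.1 - p.1| < r)
    (h2 : riemannianDist E p.2 q.2 < r) :
    nullEDist (𝓘(ℝ, ℝ).prod 𝓘(ℝ, E)) (productMetric E) (timeField E) Prod.fst p q ≤
      ENNReal.ofReal r := by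
  obtain ⟨c, l, l', hc, c0, c1, hl', hl, hpos, hle, l0, l1⟩ :=
    exists_contMDiff_of_riemannianDist_lt h2
  obtain ⟨h1l, h1r⟩ := abs_lt.1 h1
  have hlc : Continuous l := continuous_iff_continuousAt.2 fun s ↦ (hl s).continuousAt
  have hmono : StrictMono l := strictMono_of_hasDerivAt_pos hl hpos
  obtain ⟨s₀, -, hs₀⟩ : (r + (q.1 - p.1)) / 2 ∈ l '' Icc 0 1 := by
    apply intermediate_value_Icc zero_le_one hlc.continuousOn
    rw [l0, l1]
    constructor <;> linarith
  have hs0 : 0 < s₀ := by rw [← hmono.lt_iff_lt, l0, hs₀]; linarith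
  have hs1 : s₀ < 1 := by rw [← hmono.lt_iff_lt, l1, hs₀]; linarith
  -- a tent function of `l`, with its top at `s₀`
  let τ : ℝ → ℝ := fun s ↦ p.1 + l s₀ - |l s - l s₀|
  have hτL : ∀ s ≤ s₀, τ s = p.1 + l s := fun s hs ↦ by
    simp only [τ]
    rw [abs_of_nonpos (sub_nonpos.2 (hmono.monotone hs))]
    ring
  have hτR : ∀ s, s₀ ≤ s → τ s = p.1 + 2 * l s₀ - l s := fun s hs ↦ by
    simp only [τ]
    rw [abs_of_nonneg (sub_nonneg.2 (hmono.monotone hs))]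
    ring
  have hcl := isLocallyLipschitzCurve_of_contMDiff hc
  have hd1 : ∀ s, HasDerivAt (fun s ↦ p.1 + l s) (l' s) s := fun s ↦ (hl s).const_add _
  have hd2 : ∀ s, HasDerivAt (fun s ↦ p.1 + 2 * l s₀ - l s) (-l' s) s := fun s ↦
    (hl s).const_sub _
  have hf : IsFutureCausalCurve (𝓘(ℝ, ℝ).prod 𝓘(ℝ, E)) (productMetric E) (timeField E)
      (fun s ↦ (τ s, c s)) 0 s₀ := by
    obtain ⟨K, hK⟩ := exists_lipschitzOnWith_Icc_of_hasDerivAt hl' hd1 0 s₀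
    refine isFutureCausalCurve_prodMk (K := K) hs0 (fun s hs t ht ↦ by
      rw [hτL s hs.2, hτL t ht.2]; exact hK hs ht) (hcl _) ?_
    rw [← restrict_Ioo_eq_restrict_Icc]
    filter_upwards [ae_restrict_mem measurableSet_Ioo] with s hs
    refine ⟨(hc s).mdifferentiableAt one_ne_zero, l' s, ?_, hpos s, hle s⟩
    refine (hd1 s).congr_of_eventuallyEq ?_
    filter_upwards [Iio_mem_nhds hs.2] with t ht using hτL t (le_of_lt ht)
  have hp : IsPastCausalCurve (𝓘(ℝ, ℝ).prod 𝓘(ℝ, E)) (productMetric E) (timeField E)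
      (fun s ↦ (τ s, c s)) s₀ 1 := by
    obtain ⟨K, hK⟩ := exists_lipschitzOnWith_Icc_of_hasDerivAt (hl'.neg) hd2 s₀ 1
    refine isPastCausalCurve_prodMk (K := K) hs1 (fun s hs t ht ↦ by
      rw [hτR s hs.1, hτR t ht.1]; exact hK hs ht) (hcl _) ?_
    rw [← restrict_Ioo_eq_restrict_Icc]
    filter_upwards [ae_restrict_mem measurableSet_Ioo] with s hs
    refine ⟨(hc s).mdifferentiableAt one_ne_zero, l' s, ?_, hpos s, hle s⟩
    refine (hd2 s).congr_of_eventuallyEq ?_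
    filter_upwards [Ioi_mem_nhds hs.1] with t ht using hτR t (le_of_lt ht)
  let a : ℕ → ℝ := fun i ↦ if i = 0 then 0 else if i = 1 then s₀ else 1
  have hτ0 : τ 0 = p.1 := by rw [hτL 0 hs0.le, l0, add_zero]
  have hτ1 : τ 1 = q.1 := by rw [hτR 1 hs1.le, l1, hs₀]; ring
  have hτs : τ s₀ = p.1 + l s₀ := hτL s₀ le_rfl
  have hpc : IsPiecewiseCausal (𝓘(ℝ, ℝ).prod 𝓘(ℝ, E)) (productMetric E) (timeField E)
      (fun s ↦ (τ s, c s)) 2 a := by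
    refine ⟨two_pos, fun i hi ↦ ?_⟩
    interval_cases i
    · exact Or.inl hf
    · exact Or.inr hp
  refine (iInf₂_le (fun s ↦ (τ s, c s)) 2).trans
    ((iInf₂_le a ⟨hpc, Prod.ext hτ0 c0, Prod.ext hτ1 c1⟩).trans ?_)
  apply ENNReal.ofReal_le_ofReal
  simp only [nullLength, Finset.sum_range_succ, Finset.sum_range_zero, a]
  norm_num
  rw [hτ0, hτ1, hτs, add_sub_cancel_left, hs₀, abs_of_nonneg (by linarith),
    abs_of_nonpos (by linarith)]
  linarith

theorem riemannianDist_le_nullLength {γ : ℝ → ℝ × S} {k : ℕ} {a : ℕ → ℝ}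
    (h : ∀ i < k,
      IsFutureCausalCurve (𝓘(ℝ, ℝ).prod 𝓘(ℝ, E)) (productMetric E) (timeField E) γ
        (a i) (a (i + 1)) ∨
      IsPastCausalCurve (𝓘(ℝ, ℝ).prod 𝓘(ℝ, E)) (productMetric E) (timeField E) γ
        (a i) (a (i + 1))) :
    riemannianDist E (γ (a 0)).2 (γ (a k)).2 ≤ nullLength Prod.fst γ k a := by
  induction k with
  | zero => simp [nullLength, riemannianDist_self]
  | succ k ih =>
    rw [nullLength, Finset.sum_range_succ]
    refine (riemannianDist_triangle E _ (γ (a k)).2 _).trans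
      (add_le_add (ih fun i hi ↦ h i (by omega)) ?_)
    obtain h1 | h1 := h k (by omega)
    · exact h1.riemannianDist_le.trans (le_abs_self _)
    · rw [abs_sub_comm]
      exact h1.riemannianDist_le.trans (le_abs_self _)

/-- The formula for the null distance. The lower bound holds on each causal piece, where the distance
of the projections is at most the time elapsed. -/
theorem nullEDist_fst_eq (p q : ℝ × S) :
    nullEDist (𝓘(ℝ, ℝ).prod 𝓘(ℝ, E)) (productMetric E) (timeField E) Prod.fst p q =
      max (ENNReal.ofReal |q.1 - p.1|) (riemannianEDist 𝓘(ℝ, E) p.2 q.2) := by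
  rw [← ofReal_riemannianDist, ← ENNReal.ofReal_max]
  apply le_antisymm
  · apply ENNReal.le_of_forall_pos_le_add
    intro ε hε _
    rw [← ENNReal.ofReal_coe_nnreal, ← ENNReal.ofReal_add (by positivity) ε.coe_nonneg]
    have hε' : (0 : ℝ) < ε := hε
    exact nullEDist_le_of_lt (lt_add_of_le_of_pos (le_max_left _ _) hε')
      (lt_add_of_le_of_pos (le_max_right _ _) hε')
  · refine le_iInf fun γ ↦ le_iInf fun k ↦ le_iInf fun a ↦ le_iInf ?_
    rintro ⟨h, rfl, rfl⟩
    exact ENNReal.ofReal_le_ofReal (max_le (abs_sub_le_nullLength Prod.fst γ k a)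
      (riemannianDist_le_nullLength h.2))

end Product

/-! ### Geodesics and causal diamonds -/

section Product

variable {E : Type*} [NormedAddCommGroup E] [NormedSpace ℝ E]
  {S : Type*} [TopologicalSpace S] [ChartedSpace E S]
  [RiemannianBundle (fun x : S ↦ TangentSpace 𝓘(ℝ, E) x)]
  [IsManifold 𝓘(ℝ, E) 1 S] [PreconnectedSpace S]
  [IsContinuousRiemannianBundle E (fun x : S ↦ TangentSpace 𝓘(ℝ, E) x)]

/-- Two points at distance less than `L` are joined by a curve on `[0, T]` with Lipschitz constant
`L / T`. It is an almost shortest curve, reparametrized by its arc length majorant. -/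
theorem exists_approx_geodesic {x y : S} {T L : ℝ} (hT : 0 < T) (h : riemannianDist E x y < L) :
    ∃ g : ℝ → S, g 0 = x ∧ g T = y ∧ ∀ u ∈ Icc 0 T, ∀ v ∈ Icc 0 T,
      riemannianDist E (g u) (g v) ≤ |v - u| * (L / T) := by
  have hL : 0 < L := (riemannianDist_nonneg E x y).trans_lt h
  obtain ⟨c, l, l', hc, c0, c1, hl', hl, hpos, hle, l0, l1⟩ :=
    exists_contMDiff_of_riemannianDist_lt h
  have hlc : Continuous l := continuous_iff_continuousAt.2 fun s ↦ (hl s).continuousAt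
  have hmono : StrictMono l := strictMono_of_hasDerivAt_pos hl hpos
  have hs : ∀ u ∈ Icc 0 T, ∃ s, l s = u * (L / T) := by
    intro u hu
    have : u * (L / T) ∈ l '' Icc 0 1 := by
      apply intermediate_value_Icc zero_le_one hlc.continuousOn
      rw [l0, l1]
      refine ⟨mul_nonneg hu.1 (by positivity), ?_⟩
      rw [mul_div_assoc', div_le_iff₀ hT, mul_comm]
      exact mul_le_mul_of_nonneg_left hu.2 hL.le
    obtain ⟨s, -, hs⟩ := this
    exact ⟨s, hs⟩
  choose! σ hσ using hs
  have hdist : ∀ s t, s ≤ t → riemannianDist E (c s) (c t) ≤ l t - l s := fun s t hst ↦ by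
    obtain ⟨K, hK⟩ := exists_lipschitzOnWith_Icc_of_hasDerivAt hl' hl s t
    exact riemannianDist_le_of_ae_norm_mfderiv_le hst (isLocallyLipschitzCurve_of_contMDiff hc _)
      hK (ae_of_all _ fun r ↦ ⟨(hc r).mdifferentiableAt one_ne_zero, l' r, hl r, hle r⟩)
  refine ⟨c ∘ σ, ?_, ?_, ?_⟩
  · have h0 : l (σ 0) = l 0 := by rw [hσ 0 ⟨le_rfl, hT.le⟩, l0, zero_mul]
    simp [hmono.injective h0, c0]
  · have h0 : l (σ T) = l 1 := by
      rw [hσ T ⟨hT.le, le_rfl⟩, l1, mul_div_cancel₀ _ hT.ne']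
    simp [hmono.injective h0, c1]
  · have key : ∀ u ∈ Icc 0 T, ∀ v ∈ Icc 0 T, u ≤ v →
        riemannianDist E (c (σ u)) (c (σ v)) ≤ (v - u) * (L / T) := by
      intro u hu v hv huv
      have h1 : σ u ≤ σ v := by
        rw [← hmono.le_iff_le, hσ u hu, hσ v hv]
        gcongr
      refine (hdist _ _ h1).trans_eq ?_
      rw [hσ u hu, hσ v hv]
      ring
    intro u hu v hv
    rcases le_total u v with huv | huv
    · rw [abs_of_nonneg (sub_nonneg.2 huv)]
      exact key u hu v hv huv
    · rw [abs_sub_comm, abs_of_nonneg (sub_nonneg.2 huv), riemannianDist_comm]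
      exact key v hv u hu huv

/-- If balls are compact, two points at distance at most `T` are joined by a `1`-Lipschitz curve on
`[0, T]`. It is the pointwise limit, along an ultrafilter, of curves with Lipschitz constants
`1 + 1 / (n + 1)`; no equicontinuity is needed, the Lipschitz bound passes to the limit. -/
theorem exists_lipschitz_of_isCompact [T2Space S] {x y : S} {T : ℝ} (hT : 0 < T)
    (h : riemannianDist E x y ≤ T)
    (hK : IsCompact {z | riemannianDist E x z ≤ T * 2}) :
    ∃ f : ℝ → S, f 0 = x ∧ f T = y ∧ ∀ s t, riemannianEDist 𝓘(ℝ, E) (f s) (f t) ≤ ‖t - s‖ₑ := by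
  have hg : ∀ n : ℕ, ∃ g : ℝ → S, g 0 = x ∧ g T = y ∧ ∀ u ∈ Icc 0 T, ∀ v ∈ Icc 0 T,
      riemannianDist E (g u) (g v) ≤ |v - u| * (1 + 1 / ((n : ℝ) + 1)) := by
    intro n
    have hn : (0 : ℝ) < 1 / ((n : ℝ) + 1) := by positivity
    have hlt : riemannianDist E x y < T * (1 + 1 / ((n : ℝ) + 1)) := by nlinarith
    simpa only [mul_div_cancel_left₀ _ hT.ne'] using exists_approx_geodesic hT hlt
  choose g g0 gT hgd using hg
  -- values at a given parameter stay in the compact ball of radius `2 T`, so they converge along `𝒰`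
  let 𝒰 : Ultrafilter ℕ := hyperfilter ℕ
  have hlim : ∀ u ∈ Icc 0 T, ∃ z, Tendsto (fun n ↦ g n u) 𝒰 (𝓝 z) := by
    intro u hu
    obtain ⟨z, -, hz⟩ := hK.ultrafilter_le_nhds (𝒰.map fun n ↦ g n u) (by
      rw [le_principal_iff]
      refine Eventually.of_forall (f := (𝒰 : Filter ℕ)) fun n ↦ ?_
      have h1 := hgd n 0 ⟨le_rfl, hT.le⟩ u hu
      rw [g0, sub_zero, abs_of_nonneg hu.1] at h1
      refine h1.trans ?_
      have : (1 : ℝ) / ((n : ℝ) + 1) ≤ 1 := by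
        rw [div_le_one (by positivity)]
        linarith [n.cast_nonneg (α := ℝ)]
      exact mul_le_mul hu.2 (by linarith) (by positivity) hT.le)
    exact ⟨z, hz⟩
  have : Nonempty S := ⟨x⟩
  choose! φ hφ using hlim
  have hφd : ∀ u ∈ Icc 0 T, ∀ v ∈ Icc 0 T, riemannianDist E (φ u) (φ v) ≤ |v - u| := by
    intro u hu v hv
    have h1 : Tendsto (fun n ↦ riemannianDist E (g n u) (g n v)) 𝒰
        (𝓝 (riemannianDist E (φ u) (φ v))) :=
      ((continuous_riemannianDist E).tendsto (φ u, φ v)).comp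
        ((hφ u hu).prodMk_nhds (hφ v hv))
    have h2 : Tendsto (fun n : ℕ ↦ |v - u| * (1 + 1 / ((n : ℝ) + 1))) 𝒰 (𝓝 |v - u|) := by
      have := (tendsto_one_div_add_atTop_nhds_zero_nat (𝕜 := ℝ)).const_add 1 |>.const_mul |v - u|
      rw [add_zero, mul_one] at this
      exact this.mono_left Nat.hyperfilter_le_atTop
    exact le_of_tendsto_of_tendsto' h1 h2 fun n ↦ hgd n u hu v hv
  have h0 : φ 0 = x := tendsto_nhds_unique (hφ 0 ⟨le_rfl, hT.le⟩)
    (tendsto_const_nhds.congr fun n ↦ (g0 n).symm)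
  have h1 : φ T = y := tendsto_nhds_unique (hφ T ⟨hT.le, le_rfl⟩)
    (tendsto_const_nhds.congr fun n ↦ (gT n).symm)
  -- extended by constants, so that the bound holds on the whole line
  refine ⟨fun s ↦ φ (projIcc 0 T hT.le s), by simpa using h0, by simpa using h1, fun s t ↦ ?_⟩
  rw [← ofReal_norm, ← riemannianDist_le_iff (norm_nonneg _)]
  refine (hφd _ (projIcc 0 T hT.le s).2 _ (projIcc 0 T hT.le t).2).trans ?_
  rw [Real.norm_eq_abs]
  exact abs_projIcc_sub_projIcc hT.le

/-- If balls are compact, the causal relation is the closed cone condition: the curve `(p.1 + s, f s)`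
is causal, with `f` a `1`-Lipschitz curve of `S`. -/
theorem causalLE_of_riemannianDist_le [FiniteDimensional ℝ E] [T2Space S] [RegularSpace S]
    (hK : ∀ (x : S) (r : ℝ), IsCompact {z | riemannianDist E x z ≤ r}) {p q : ℝ × S}
    (h : riemannianDist E p.2 q.2 ≤ q.1 - p.1) :
    CausalLE (𝓘(ℝ, ℝ).prod 𝓘(ℝ, E)) (productMetric E) (timeField E) p q := by
  have h0 := (riemannianDist_nonneg E p.2 q.2).trans h
  rcases h0.eq_or_lt with h1 | hT
  · right
    rw [← h1] at h
    have hd : riemannianEDist 𝓘(ℝ, E) p.2 q.2 = 0 := by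
      rw [← ofReal_riemannianDist]
      exact ENNReal.ofReal_of_nonpos h
    refine Prod.ext (by linarith) ?_
    by_contra hne
    obtain ⟨c, hc, hcs⟩ := setOfPred_riemannianEDist_lt_subset_nhds' 𝓘(ℝ, E)
      (isOpen_compl_singleton.mem_nhds (show p.2 ∈ ({q.2}ᶜ : Set S) from hne))
    exact hcs (show riemannianEDist 𝓘(ℝ, E) p.2 q.2 < c by rwa [hd]) rfl
  · left
    obtain ⟨f, f0, fT, hf⟩ := exists_lipschitz_of_isCompact hT h (hK _ _)
    refine ⟨fun s ↦ (p.1 + s, f s), 0, q.1 - p.1, ?_, ?_, ?_⟩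
    · refine isFutureCausalCurve_prodMk (K := 1) hT ?_
        (isLocallyLipschitzCurve_of_riemannianEDist_le hf _) ?_
      · exact ((isometry_add_left p.1).lipschitz).lipschitzOnWith
      · filter_upwards [ae_restrict_of_ae (ae_mdifferentiableAt_of_riemannianEDist_le hf)]
          with s hs
        exact ⟨hs, 1, (hasDerivAt_id s).const_add p.1, one_pos,
          norm_mfderiv_le_one_of_riemannianEDist_le hs (Eventually.of_forall (hf s))⟩
    · simp [f0]
    · simp [fT]

theorem HeineBorel.isCompact_setOf_riemannianDist_le
    (h : HeineBorel (riemannianEDist 𝓘(ℝ, E) (M := S))) (x : S) (r : ℝ) :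
    IsCompact {z | riemannianDist E x z ≤ r} := by
  refine h _ (isClosed_le ((continuous_riemannianDist E).comp
    (continuous_const (y := x) |>.prodMk continuous_id)) continuous_const)
    ⟨(r + r).toNNReal, fun y hy z hz ↦ ?_⟩
  rw [← ofReal_riemannianDist]
  apply ENNReal.ofReal_le_ofReal
  refine (riemannianDist_triangle E y x z).trans ?_
  rw [riemannianDist_comm E y x]
  exact add_le_add hy hz

theorem HeineBorel.isCompact_causalDiamond [FiniteDimensional ℝ E] [T2Space S] [RegularSpace S]
    (h : HeineBorel (riemannianEDist 𝓘(ℝ, E) (M := S))) (p q : ℝ × S) :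
    IsCompact (causalDiamond (𝓘(ℝ, ℝ).prod 𝓘(ℝ, E)) (productMetric E) (timeField E) p q) := by
  have hK := h.isCompact_setOf_riemannianDist_le
  have heq : causalDiamond (𝓘(ℝ, ℝ).prod 𝓘(ℝ, E)) (productMetric E) (timeField E) p q =
      {x | riemannianDist E p.2 x.2 ≤ x.1 - p.1} ∩ {x | riemannianDist E x.2 q.2 ≤ q.1 - x.1} := by
    ext x
    exact and_congr ⟨CausalLE.riemannianDist_le, causalLE_of_riemannianDist_le hK⟩
      ⟨CausalLE.riemannianDist_le, causalLE_of_riemannianDist_le hK⟩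
  rw [heq]
  refine (isCompact_Icc.prod (hK p.2 (q.1 - p.1))).of_isClosed_subset
    (s := Icc p.1 q.1 ×ˢ {z | riemannianDist E p.2 z ≤ q.1 - p.1}) ?_ ?_
  · refine IsClosed.inter ?_ ?_
    · exact isClosed_le ((continuous_riemannianDist E).comp
        (continuous_const.prodMk continuous_snd)) (by fun_prop)
    · exact isClosed_le ((continuous_riemannianDist E).comp
        (continuous_snd.prodMk continuous_const)) (by fun_prop)
  · rintro x ⟨h1, h2⟩
    have h1 : riemannianDist E p.2 x.2 ≤ x.1 - p.1 := h1
    have h2 : riemannianDist E x.2 q.2 ≤ q.1 - x.1 := h2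
    have h3 := riemannianDist_nonneg E p.2 x.2
    have h4 := riemannianDist_nonneg E x.2 q.2
    refine ⟨⟨by linarith, by linarith⟩, ?_⟩
    change riemannianDist E p.2 x.2 ≤ q.1 - p.1
    linarith

/-- A bounded set is contained in the slice `t = 0` of a causal diamond over one of its points. The
radius is enlarged by `1` so that only the chronological part of the relation is used. -/
theorem heineBorel_of_isCompact_causalDiamond
    (h : ∀ p q : ℝ × S, IsCompact
      (causalDiamond (𝓘(ℝ, ℝ).prod 𝓘(ℝ, E)) (productMetric E) (timeField E) p q)) :
    HeineBorel (riemannianEDist 𝓘(ℝ, E) (M := S)) := by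
  rintro C hC ⟨r, hr⟩
  rcases C.eq_empty_or_nonempty with rfl | ⟨x, hx⟩
  · exact isCompact_empty
  refine ((h (-(r + 1), x) (r + 1, x)).image continuous_snd).of_isClosed_subset hC ?_
  intro y hy
  have hxy : riemannianDist E x y ≤ r := by
    rw [riemannianDist_le_iff r.coe_nonneg, ENNReal.ofReal_coe_nnreal]
    exact hr x hx y hy
  refine ⟨(0, y), ⟨Or.inl ?_, Or.inl ?_⟩, rfl⟩
  · apply existsCausalCurve_of_riemannianDist_lt
    simp only
    linarith
  · apply existsCausalCurve_of_riemannianDist_lt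
    simp only
    rw [riemannianDist_comm]
    linarith

end Product

/-! ### Completeness of a product with the real line -/

section Complete

variable {Y : Type*} {d : Y → Y → ℝ≥0∞} {D : ℝ × Y → ℝ × Y → ℝ≥0∞}

theorem IsCompleteMetric.prod_real (hD : ∀ p q, D p q = max (ENNReal.ofReal |q.1 - p.1|) (d p.2 q.2))
    (h : IsCompleteMetric d) : IsCompleteMetric D where
  ne_top p q := by
    rw [hD]
    exact max_ne_top ENNReal.ofReal_ne_top (h.ne_top _ _)
  eq_zero_iff p q := by
    rw [hD, ← bot_eq_zero, max_eq_bot, bot_eq_zero, ENNReal.ofReal_eq_zero, h.eq_zero_iff,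
      abs_nonpos_iff, sub_eq_zero, Prod.ext_iff, eq_comm (a := q.1)]
  symm p q := by rw [hD, hD, abs_sub_comm, h.symm]
  triangle p q r := by
    rw [hD, hD p q, hD q r]
    refine max_le ?_ ((h.triangle _ q.2 _).trans (add_le_add (le_max_right _ _) (le_max_right _ _)))
    refine le_trans ?_ (add_le_add (le_max_left _ _) (le_max_left _ _))
    rw [← ENNReal.ofReal_add (abs_nonneg _) (abs_nonneg _), add_comm]
    exact ENNReal.ofReal_le_ofReal (abs_sub_le _ _ _)
  complete u hu := by
    obtain ⟨x, hx⟩ := h.complete (fun n ↦ (u n).2) fun ε hε ↦ by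
      obtain ⟨N, hN⟩ := hu ε hε
      refine ⟨N, fun m hm n hn ↦ lt_of_le_of_lt ?_ (hN m hm n hn)⟩
      rw [hD]
      exact le_max_right _ _
    have hc : CauchySeq fun n ↦ (u n).1 := by
      rw [Metric.cauchySeq_iff]
      intro ε hε
      obtain ⟨N, hN⟩ := hu (ENNReal.ofReal ε) (ENNReal.ofReal_pos.2 hε)
      refine ⟨N, fun m hm n hn ↦ ?_⟩
      have h1 : ENNReal.ofReal |(u n).1 - (u m).1| < ENNReal.ofReal ε :=
        lt_of_le_of_lt (by rw [hD]; exact le_max_left _ _) (hN m hm n hn)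
      rw [dist_comm, Real.dist_eq]
      exact (ENNReal.ofReal_lt_ofReal_iff hε).1 h1
    obtain ⟨t, ht⟩ := cauchySeq_tendsto_of_complete hc
    refine ⟨(t, x), ?_⟩
    simp only [hD]
    have h1 : Tendsto (fun n ↦ ENNReal.ofReal |t - (u n).1|) atTop (𝓝 0) := by
      have := (ENNReal.continuous_ofReal.comp continuous_abs).tendsto 0 |>.comp
        (by simpa using ht.const_sub t : Tendsto (fun n ↦ t - (u n).1) atTop (𝓝 0))
      simpa [Function.comp_def] using this
    simpa using h1.max hx

theorem IsCompleteMetric.of_prod_real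
    (hD : ∀ p q, D p q = max (ENNReal.ofReal |q.1 - p.1|) (d p.2 q.2))
    (h : IsCompleteMetric D) : IsCompleteMetric d := by
  have hd : ∀ x y, d x y = D (0, x) (0, y) := fun x y ↦ by simp [hD]
  refine ⟨fun x y ↦ ?_, fun x y ↦ ?_, fun x y ↦ ?_, fun x y z ↦ ?_, fun u hu ↦ ?_⟩
  · rw [hd]; exact h.ne_top _ _
  · rw [hd, h.eq_zero_iff]; simp
  · rw [hd, hd, h.symm]
  · rw [hd, hd x y, hd y z]; exact h.triangle _ _ _
  · obtain ⟨x, hx⟩ := h.complete (fun n ↦ (0, u n)) (by simpa only [← hd] using hu)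
    refine ⟨x.2, tendsto_of_tendsto_of_tendsto_of_le_of_le tendsto_const_nhds hx
      (fun _ ↦ zero_le) fun n ↦ ?_⟩
    simp only [hD]
    exact le_max_right _ _

end Complete

end Spacetime

end

theorem theorem1p3
    {E : Type*} [NormedAddCommGroup E] [NormedSpace ℝ E] [FiniteDimensional ℝ E]
    {S : Type*} [TopologicalSpace S] [T2Space S] [ParacompactSpace S] [ConnectedSpace S]
    [ChartedSpace E S] [IsManifold 𝓘(ℝ, E) ∞ S]
    [RiemannianBundle (fun x : S ↦ TangentSpace 𝓘(ℝ, E) x)]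
    [IsContMDiffRiemannianBundle 𝓘(ℝ, E) ∞ E (fun x : S ↦ TangentSpace 𝓘(ℝ, E) x)] :
    Spacetime.IsSpacetime (𝓘(ℝ, ℝ).prod 𝓘(ℝ, E))
      (Spacetime.productMetric E (S := S)) (Spacetime.timeField E) ∧
    Spacetime.IsStablyCausal (𝓘(ℝ, ℝ).prod 𝓘(ℝ, E))
      (Spacetime.productMetric E (S := S)) (Spacetime.timeField E) ∧
    Spacetime.IsTimeFunction (𝓘(ℝ, ℝ).prod 𝓘(ℝ, E))
      (Spacetime.productMetric E (S := S)) (Spacetime.timeField E) Prod.fst ∧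
    (Spacetime.HeineBorel (Manifold.riemannianEDist 𝓘(ℝ, E) (M := S)) ↔
      Spacetime.IsGloballyHyperbolic (𝓘(ℝ, ℝ).prod 𝓘(ℝ, E))
        (Spacetime.productMetric E (S := S)) (Spacetime.timeField E)) ∧
    (Spacetime.HeineBorel (Manifold.riemannianEDist 𝓘(ℝ, E) (M := S)) ↔
      ∀ p q : ℝ × S, IsCompact (Spacetime.causalDiamond (𝓘(ℝ, ℝ).prod 𝓘(ℝ, E))
        (Spacetime.productMetric E (S := S)) (Spacetime.timeField E) p q)) ∧
    (Spacetime.IsCompleteMetric (Manifold.riemannianEDist 𝓘(ℝ, E) (M := S)) ↔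
      Spacetime.IsCompleteMetric (Spacetime.nullEDist (𝓘(ℝ, ℝ).prod 𝓘(ℝ, E))
        (Spacetime.productMetric E (S := S)) (Spacetime.timeField E) Prod.fst)) ∧
    (∀ p q : ℝ × S,
      Spacetime.nullEDist (𝓘(ℝ, ℝ).prod 𝓘(ℝ, E))
        (Spacetime.productMetric E (S := S)) (Spacetime.timeField E) Prod.fst p q =
      max (ENNReal.ofReal |q.1 - p.1|) (Manifold.riemannianEDist 𝓘(ℝ, E) p.2 q.2)) := by
  have : IsContinuousRiemannianBundle E (fun x : S ↦ TangentSpace 𝓘(ℝ, E) x) := by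
    obtain ⟨g, hg, h⟩ := IsContMDiffRiemannianBundle.exists_contMDiff (IB := 𝓘(ℝ, E)) (n := ∞)
      (F := E) (E := fun x : S ↦ TangentSpace 𝓘(ℝ, E) x)
    exact ⟨g, hg.continuous, h⟩
  have hcausal := Spacetime.isCausal_scaledProductMetric (E := E) (S := S) zero_lt_one
  have hst := Spacetime.isSpacetime_scaledProductMetric (E := E) (S := S) zero_lt_one
  rw [Spacetime.scaledProductMetric_one] at hcausal hst
  exact ⟨hst, Spacetime.isStablyCausal_productMetric, Spacetime.isTimeFunction_fst,
    ⟨fun h ↦ ⟨hcausal, h.isCompact_causalDiamond⟩,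
      fun h ↦ Spacetime.heineBorel_of_isCompact_causalDiamond h.2⟩,
    ⟨fun h ↦ h.isCompact_causalDiamond, Spacetime.heineBorel_of_isCompact_causalDiamond⟩,
    ⟨.prod_real Spacetime.nullEDist_fst_eq, .of_prod_real Spacetime.nullEDist_fst_eq⟩,
    Spacetime.nullEDist_fst_eq⟩
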